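/- Let $N\ge 2$, let $U\subseteq\mathbb R^N$ be open (the domain of the given orthogonal coordinates $x=(x^1,\dots,x^N)$), let $2\le r\le\omega$ be a class of differentiability (so $r=\infty$ and $r=\omega$, real analytic, are included), and let $${\cal H}=\sum_{i=1}^N H_i^{-2}(x)\,p_i^2+V(x),\qquad {\cal L}=\sum_{i=1}^N L_i(x)\,p_i^2+W(x)$$ be functions on phase space whose coefficients are real functions of class $C^r$ on $U$. Assume that every $H_i^{-2}$ (which may have either sign: pseudo-Riemannian case) is nowhere zero on $U$. Put $R_i=-\partial_{x^i}{\cal H}/\partial_{p_i}{\cal H}$ and $D_i=\partial_{x^i}+R_i\,\partial_{p_i}$; this $D_i$ is tangent to the level sets of ${\cal H}$. We say that a phase-space function vanishes modulo ${\cal L}$ if, for each $x$, it is ${\cal L}$ times a polynomial in the momenta. Suppose that ${\cal H}$ admits maximal nonregular separation on the submanifold ${\cal L}=0$ in these coordinates, that is: * ${\cal H}$ and ${\cal L}$ are pointwise independent: for every $x\in U$ the vectors $(H_i^{-2}(x))_i$ and $(L_i(x))_i$ are linearly independent; * each $D_i$ is tangent to ${\cal L}=0$: $D_i{\cal L}$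 vanishes modulo ${\cal L}$; * the distribution spanned by the $D_i$ is integrable on ${\cal L}=0$: $[D_i,D_j]=(D_iR_j)\partial_{p_j}-(D_jR_i)\partial_{p_i}$ is zero there, in the sense that $p_j\,D_iR_j$ vanishes modulo ${\cal L}$ for all $i\ne j$. Then every $x_0\in U$ is the center of an open coordinate cube $B\subseteq U$ on which the system is separable with the side condition ${\cal L}=0$ by means of a generalized Stäckel matrix. Precisely, there are functions $s_{i\xi}(x^i)$ ($1\le i\le N$, $1\le\xi\le N-1$) and $v_i(x^i)$ of one variable and functions $a_i(x)$ on $B$, all of class $C^r$, such that the matrix $S(x)$ with first $N-1$ columns $(s_{i\xi}(x^i))_i$ and last column $(a_i(x))_i$ is nonsingular at every point of $B$ and, with $T=S^{-1}$: 1. $H_j^{-2}=T^{1j}$, $V=\sum_j v_jT^{1j}$, $L_j=T^{Nj}$, $W=\sum_j v_jT^{Nj}$ on $B$; that is, ${\cal H}={\cal L}^1$ and ${\cal L}={\cal L}^N$, where ${\cal L}^\ell=\sum_j T^{\ell j}(p_j^2+v_j)$; 2. on every cube contained in $B$, a $C^2$ real or complex valued function $u$ with $\partial_i\partial_ju=0$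 for $i\ne j$ satisfies both the Hamilton–Jacobi equation $\sum_iH_i^{-2}(\partial_iu)^2+V=E$ and the side condition $\sum_iL_i(\partial_iu)^2+W=0$ if and only if there are constants $\lambda_1=-E,\lambda_2,\dots,\lambda_{N-1}$ (real or complex, respectively) with $$(\partial_iu)^2+v_i(x^i)+\sum_{\xi=1}^{N-1}s_{i\xi}(x^i)\lambda_\xi=0,\qquad i=1,\dots,N;$$ 3. the $N-1$ constants are free: for all complex $\lambda_1,\dots,\lambda_{N-1}$ and all $x_1\in B$ such that, for each $i$, the function $v_i+\sum_\xi s_{i\xi}\lambda_\xi$ is nonzero at $x_1^i$ or is identically zero, these separation equations have a complex valued $C^2$ solution $u$ with $\partial_i\partial_ju=0$ ($i\ne j$) on some cube around $x_1$; 4. ${\cal L}^1,\dots,{\cal L}^N$ are in involution modulo the side condition: each Poisson bracket $\{{\cal L}^k,{\cal L}^m\}$ vanishes modulo ${\cal L}^N$. -/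

import Mathlib

namespace NonregSep

/-- The partial derivative `∂f/∂xⁱ` at `x`, in `ℝ^N`. -/
noncomputable def pd {N : ℕ} {𝕜 : Type*} [RCLike 𝕜]
    (i : Fin N) (f : (Fin N → ℝ) → 𝕜) (x : Fin N → ℝ) : 𝕜 :=
  fderiv ℝ f x (Pi.single i 1)

/-- The phase-space function `∑ gᵢ(x) pᵢ² + G(x)`, quadratic and diagonal in the momenta. -/
def quadFn {N : ℕ} (g : Fin N → (Fin N → ℝ) → ℝ) (G : (Fin N → ℝ) → ℝ)
    (x p : Fin N → ℝ) : ℝ :=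
  ∑ i, g i x * p i ^ 2 + G x

/-- `∂F/∂xⁱ` for a phase-space function `F(x, p)`. -/
noncomputable def dx {N : ℕ} (i : Fin N) (F : (Fin N → ℝ) → (Fin N → ℝ) → ℝ)
    (x p : Fin N → ℝ) : ℝ :=
  pd i (fun y => F y p) x

/-- `∂F/∂pᵢ` for a phase-space function `F(x, p)`. -/
noncomputable def dp {N : ℕ} (i : Fin N) (F : (Fin N → ℝ) → (Fin N → ℝ) → ℝ)
    (x p : Fin N → ℝ) : ℝ :=
  pd i (F x) p

/-- The Poisson bracket `{F, G} = ∑ (∂G/∂xⁱ ∂F/∂pᵢ - ∂F/∂xⁱ ∂G/∂pᵢ)`. -/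
noncomputable def poisson {N : ℕ} (F G : (Fin N → ℝ) → (Fin N → ℝ) → ℝ)
    (x p : Fin N → ℝ) : ℝ :=
  ∑ i, (dx i G x p * dp i F x p - dx i F x p * dp i G x p)

/-- The coefficient `Rᵢ` of `Dᵢ = ∂/∂xⁱ + Rᵢ ∂/∂pᵢ`, determined (where `∂F/∂pᵢ ≠ 0`) by the
requirement that `Dᵢ` is tangent to the level sets of `F`. On the graph `pᵢ = ∂ᵢu` of a separated
solution of `F = E`, this is `∂ᵢ∂ᵢu`. -/
noncomputable def coeffR {N : ℕ} (F : (Fin N → ℝ) → (Fin N → ℝ) → ℝ) (i : Fin N)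
    (x p : Fin N → ℝ) : ℝ :=
  - dx i F x p / dp i F x p

/-- The vector field `Dᵢ = ∂/∂xⁱ + Rᵢ ∂/∂pᵢ` of the Hamiltonian `F`, applied to `G`. -/
noncomputable def vecD {N : ℕ} (F : (Fin N → ℝ) → (Fin N → ℝ) → ℝ) (i : Fin N)
    (G : (Fin N → ℝ) → (Fin N → ℝ) → ℝ) (x p : Fin N → ℝ) : ℝ :=
  dx i G x p + coeffR F i x p * dp i G x p

/-- `F` vanishes modulo the side condition `K = 0` over `B`: for every `x ∈ B`, as a function of
the momenta, `F` is a polynomial multiple of `K`. It is an identity of polynomials in `p`; it is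
written at momenta without zero components because the `Rᵢ` have denominators `pᵢ`.
(Mere vanishing at real points of `K = 0` would be void when `K` has no real zeros.) -/
def VanishesMod {N : ℕ} (B : Set (Fin N → ℝ)) (K F : (Fin N → ℝ) → (Fin N → ℝ) → ℝ) : Prop :=
  ∀ x ∈ B, ∃ P : MvPolynomial (Fin N) ℝ, ∀ p : Fin N → ℝ, (∀ k, p k ≠ 0) →
    F x p = MvPolynomial.eval p P * K x p

/-- Maximal nonregular separation of `ℋ = ∑ hᵢ pᵢ² + V` on the submanifold `𝓛 = 0`,
`𝓛 = ∑ ℓᵢ pᵢ² + W`, in the coordinates `x` on `U`. -/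
structure MaximalNonregularSeparation {N : ℕ} (U : Set (Fin N → ℝ))
    (h : Fin N → (Fin N → ℝ) → ℝ) (V : (Fin N → ℝ) → ℝ)
    (l : Fin N → (Fin N → ℝ) → ℝ) (W : (Fin N → ℝ) → ℝ) : Prop where
  /-- `ℋ` and `𝓛` are pointwise independent, so that the energy is one of the `N - 1` free
  separation constants on `𝓛 = 0`. -/
  independent : ∀ x ∈ U, LinearIndependent ℝ ![fun i => h i x, fun i => l i x]
  /-- Every `Dᵢ` is tangent to the submanifold `𝓛 = 0`. -/
  tangent : ∀ i, VanishesMod U (quadFn l W) (vecD (quadFn h V) i (quadFn l W))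
  /-- The distribution spanned by the `Dᵢ` is integrable on `𝓛 = 0`:
  `[Dᵢ, Dⱼ] = (Dᵢ Rⱼ) ∂/∂pⱼ - (Dⱼ Rᵢ) ∂/∂pᵢ` vanishes there. The factor `pⱼ` clears the
  denominator of `Dᵢ Rⱼ`. -/
  integrable : ∀ i j, i ≠ j → VanishesMod U (quadFn l W)
    (fun x p => p j * vecD (quadFn h V) i (coeffR (quadFn h V) j) x p)

/-- The `N × N` matrix (`N = n + 2`) whose first `N - 1` columns are `s_{iξ}(xⁱ)` and whose last
column is `aᵢ(x)`. -/
def stackelMatrix {n : ℕ} (s : Fin (n + 2) → Fin (n + 1) → ℝ → ℝ)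
    (a : Fin (n + 2) → (Fin (n + 2) → ℝ) → ℝ) (x : Fin (n + 2) → ℝ) :
    Matrix (Fin (n + 2)) (Fin (n + 2)) ℝ :=
  Matrix.of fun i => Fin.snoc (α := fun _ => ℝ) (fun ξ => s i ξ (x i)) (a i x)

/-- `s`, `a` form a generalized Stäckel matrix, of class `C^r`, on the coordinate cube of center
`x₀` and half-side `ε` (a ball for the sup distance of `ℝ^N`). -/
structure IsGeneralizedStackel {n : ℕ} (r : WithTop ℕ∞) (x₀ : Fin (n + 2) → ℝ) (ε : ℝ)
    (s : Fin (n + 2) → Fin (n + 1) → ℝ → ℝ)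
    (a : Fin (n + 2) → (Fin (n + 2) → ℝ) → ℝ) : Prop where
  contDiff_s : ∀ i ξ, ContDiffOn ℝ r (s i ξ) (Set.Ioo (x₀ i - ε) (x₀ i + ε))
  contDiff_a : ∀ i, ContDiffOn ℝ r (a i) (Metric.ball x₀ ε)
  nonsingular : ∀ x ∈ Metric.ball x₀ ε, (stackelMatrix s a x).det ≠ 0

/-- `u` is additively separated on `B`: of class `C²` with `∂ⱼ∂ᵢu = 0` for `i ≠ j`. -/
def IsSeparated {N : ℕ} {𝕜 : Type*} [RCLike 𝕜] (B : Set (Fin N → ℝ))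
    (u : (Fin N → ℝ) → 𝕜) : Prop :=
  ContDiffOn ℝ 2 u B ∧ ∀ x ∈ B, ∀ i j, i ≠ j → pd j (pd i u) x = 0

/-- `u` solves `∑ gᵢ (∂ᵢu)² + G = E` on `B`. -/
def SolvesHJ {N : ℕ} {𝕜 : Type*} [RCLike 𝕜] (B : Set (Fin N → ℝ))
    (g : Fin N → (Fin N → ℝ) → ℝ) (G : (Fin N → ℝ) → ℝ) (E : 𝕜)
    (u : (Fin N → ℝ) → 𝕜) : Prop :=
  ∀ x ∈ B, ∑ i, (g i x : 𝕜) * pd i u x ^ 2 + (G x : 𝕜) = E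

/-- The term `vᵢ(t) + ∑_ξ s_{iξ}(t) c_ξ` of the `i`-th separation equation, with the `N - 1`
separation constants `c`. -/
def sepTerm {n : ℕ} {𝕜 : Type*} [RCLike 𝕜] (s : Fin (n + 2) → Fin (n + 1) → ℝ → ℝ)
    (v : Fin (n + 2) → ℝ → ℝ) (c : Fin (n + 1) → 𝕜) (i : Fin (n + 2)) (t : ℝ) : 𝕜 :=
  (v i t : 𝕜) + ∑ ξ, (s i ξ t : 𝕜) * c ξ

/-- The separation equations `(∂ᵢu)² + vᵢ(xⁱ) + ∑_ξ s_{iξ}(xⁱ) c_ξ = 0`, `i = 1, …, N`, on `B`. -/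
def SolvesSepEqs {n : ℕ} {𝕜 : Type*} [RCLike 𝕜] (B : Set (Fin (n + 2) → ℝ))
    (s : Fin (n + 2) → Fin (n + 1) → ℝ → ℝ) (v : Fin (n + 2) → ℝ → ℝ) (c : Fin (n + 1) → 𝕜)
    (u : (Fin (n + 2) → ℝ) → 𝕜) : Prop :=
  ∀ x ∈ B, ∀ i, pd i u x ^ 2 + sepTerm s v c i (x i) = 0

/-- On every subcube, the separated solutions of the Hamilton-Jacobi equation `ℋ = E` with the
side condition `𝓛 = 0` are exactly the separated solutions of the separation equations with first
separation constant `-E`. -/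
def SepEqsGoverns {n : ℕ} (𝕜 : Type*) [RCLike 𝕜] (x₀ : Fin (n + 2) → ℝ) (ε : ℝ)
    (h : Fin (n + 2) → (Fin (n + 2) → ℝ) → ℝ) (V : (Fin (n + 2) → ℝ) → ℝ)
    (l : Fin (n + 2) → (Fin (n + 2) → ℝ) → ℝ) (W : (Fin (n + 2) → ℝ) → ℝ)
    (s : Fin (n + 2) → Fin (n + 1) → ℝ → ℝ) (v : Fin (n + 2) → ℝ → ℝ) : Prop :=
  ∀ (x₁ : Fin (n + 2) → ℝ) (δ : ℝ), 0 < δ → Metric.ball x₁ δ ⊆ Metric.ball x₀ ε →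
    ∀ (E : 𝕜) (u : (Fin (n + 2) → ℝ) → 𝕜), IsSeparated (Metric.ball x₁ δ) u →
      ((SolvesHJ (Metric.ball x₁ δ) h V E u ∧ SolvesHJ (Metric.ball x₁ δ) l W 0 u) ↔
        ∃ c : Fin (n + 1) → 𝕜, c 0 = -E ∧ SolvesSepEqs (Metric.ball x₁ δ) s v c u)

/-- The `k`-th function `∑ⱼ T^{kj} (pⱼ² + vⱼ(xʲ))`, with `T` the inverse of the generalized
Stäckel matrix. -/
noncomputable def stackelIntegral {n : ℕ} (s : Fin (n + 2) → Fin (n + 1) → ℝ → ℝ)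
    (a : Fin (n + 2) → (Fin (n + 2) → ℝ) → ℝ) (v : Fin (n + 2) → ℝ → ℝ) (k : Fin (n + 2))
    (x p : Fin (n + 2) → ℝ) : ℝ :=
  ∑ j, (stackelMatrix s a x)⁻¹ k j * (p j ^ 2 + v j (x j))

/-- The system `ℋ = ∑ hᵢ pᵢ² + V` is separable with the side condition `∑ ℓᵢ pᵢ² + W = 0` on the
cube of center `x₀` and half-side `ε`, by means of the generalized Stäckel matrix `s`, `a` and the
functions `vᵢ(xⁱ)`. -/
structure SeparableWithSideCondition {n : ℕ} (x₀ : Fin (n + 2) → ℝ) (ε : ℝ)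
    (h : Fin (n + 2) → (Fin (n + 2) → ℝ) → ℝ) (V : (Fin (n + 2) → ℝ) → ℝ)
    (l : Fin (n + 2) → (Fin (n + 2) → ℝ) → ℝ) (W : (Fin (n + 2) → ℝ) → ℝ)
    (s : Fin (n + 2) → Fin (n + 1) → ℝ → ℝ)
    (a : Fin (n + 2) → (Fin (n + 2) → ℝ) → ℝ) (v : Fin (n + 2) → ℝ → ℝ) : Prop where
  /-- The Hamiltonian is the first of the functions defined by the inverse matrix. -/
  first_row : ∀ x ∈ Metric.ball x₀ ε,
    (∀ j, (stackelMatrix s a x)⁻¹ 0 j = h j x) ∧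
      V x = ∑ j, v j (x j) * (stackelMatrix s a x)⁻¹ 0 j
  /-- The side condition is the last of the functions defined by the inverse matrix. -/
  last_row : ∀ x ∈ Metric.ball x₀ ε,
    (∀ j, (stackelMatrix s a x)⁻¹ (Fin.last (n + 1)) j = l j x) ∧
      W x = ∑ j, v j (x j) * (stackelMatrix s a x)⁻¹ (Fin.last (n + 1)) j
  /-- The separation equations govern the real separated solutions … -/
  governs_real : SepEqsGoverns ℝ x₀ ε h V l W s v
  /-- … and the complex ones. -/
  governs_complex : SepEqsGoverns ℂ x₀ ε h V l W s v
  /-- All `N - 1` separation constants are free: away from turning points, there is a local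
  separated solution for every choice of the constants. -/
  exists_solution : ∀ c : Fin (n + 1) → ℂ, ∀ x₁ ∈ Metric.ball x₀ ε,
    (∀ i, sepTerm s v c i (x₁ i) ≠ 0 ∨
      ∀ t ∈ Set.Ioo (x₀ i - ε) (x₀ i + ε), sepTerm s v c i t = 0) →
    ∃ δ > 0, Metric.ball x₁ δ ⊆ Metric.ball x₀ ε ∧
      ∃ u : (Fin (n + 2) → ℝ) → ℂ, IsSeparated (Metric.ball x₁ δ) u ∧
        SolvesSepEqs (Metric.ball x₁ δ) s v c u
  /-- The `N` functions are in involution modulo the side condition. -/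
  involution : ∀ k m, VanishesMod (Metric.ball x₀ ε) (quadFn l W)
    (poisson (stackelIntegral s a v k) (stackelIntegral s a v m))

end NonregSep

/-! With $q_i=(\partial_iu)^2$ for a separated $u$, the Hamilton–Jacobi equation and the side
condition become linear: $F=\sum_k h_kq_k(x^k)+\kappa V$ is constant and $G=\sum_k
l_kq_k(x^k)+\kappa W$ is zero. The weight $\kappa$ treats homogeneous solutions ($\kappa=0$) and
inhomogeneous ones ($\kappa=1$) together. The work is to find enough separated $q$ of this kind.

Comparing degrees in the momenta turns tangency and integrability into coefficient identities whose
factors are scalars (`exists_const_of_quad_eq_mul`). They give, for arbitrary separated $q$, a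
closed linear system: $\partial_iG$ is a combination of $G$ and $\partial_iF$, and for $i\ne j$,
$\partial_j\partial_iF$ is a combination of $G$, $\partial_iF$ and $\partial_jF$. So if $G$ vanishes
at the center and each $\partial_iF$ vanishes on the $i$-th axis, uniqueness for this Goursat
problem (`goursat_eq_zero`) makes all of them vanish on a small cube. On the axes one can solve for
$q$ algebraically (`axisFn`), which preserves the class $C^r$, so no existence theorem for
differential equations is needed. This is `exists_propagation`; its cube does not depend on $\kappa$
or on the initial values.

The initial values form the hyperplane $l(x_0)^\perp$ when $\kappa=0$. A basis adapted to $h(x_0)$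
yields the columns $s_{i\xi}$, one solution with $\kappa=1$ yields $v$, and $a$ is the combination
of $h$ and $l$ with $h\cdot a=0$, $l\cdot a=1$. These relations say that $h$ and $l$ are the first
and last rows of $S^{-1}$. The remaining claims follow from the matrix form: `sepEqsGoverns`,
`exists_separated_solution`, `vanishesMod_poisson_stackelIntegral`. -/

namespace NonregSep

/-! ### Calculus of partial derivatives. -/

section Pd

variable {N : ℕ} {𝕜 : Type*} [RCLike 𝕜] {i j : Fin N} {x : Fin N → ℝ}

theorem fderiv_apply_eq_sum_pd (f : (Fin N → ℝ) → 𝕜) (x y : Fin N → ℝ) :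
    fderiv ℝ f x y = ∑ j, y j • pd j f x := by
  conv_lhs => rw [pi_eq_sum_univ' y]
  rw [map_sum]
  refine Finset.sum_congr rfl fun j _ => ?_
  rw [map_smul]
  congr 2

theorem pd_congr {f g : (Fin N → ℝ) → 𝕜} (hfg : f =ᶠ[nhds x] g) : pd i f x = pd i g x := by
  unfold pd
  rw [hfg.fderiv_eq]

theorem pd_congr_of_isOpen {f g : (Fin N → ℝ) → 𝕜} {U : Set (Fin N → ℝ)} (hU : IsOpen U)
    (hx : x ∈ U) (hfg : ∀ y ∈ U, f y = g y) : pd i f x = pd i g x :=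
  pd_congr (Filter.eventually_of_mem (hU.mem_nhds hx) hfg)

@[simp]
theorem pd_const (a : 𝕜) : pd i (fun _ => a) x = 0 := by
  simp [pd]

theorem pd_add {f g : (Fin N → ℝ) → 𝕜} (hf : DifferentiableAt ℝ f x)
    (hg : DifferentiableAt ℝ g x) :
    pd i (fun y => f y + g y) x = pd i f x + pd i g x := by
  unfold pd
  rw [fderiv_fun_add hf hg]
  rfl

theorem pd_mul {f g : (Fin N → ℝ) → 𝕜} (hf : DifferentiableAt ℝ f x)
    (hg : DifferentiableAt ℝ g x) :
    pd i (fun y => f y * g y) x = pd i f x * g x + f x * pd i g x := by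
  unfold pd
  rw [fderiv_fun_mul hf hg]
  simp only [add_apply, smul_apply, smul_eq_mul]
  ring

theorem pd_const_mul {f : (Fin N → ℝ) → 𝕜} (a : 𝕜) (hf : DifferentiableAt ℝ f x) :
    pd i (fun y => a * f y) x = a * pd i f x := by
  rw [pd_mul (differentiableAt_const a) hf]
  simp

theorem pd_neg (f : (Fin N → ℝ) → 𝕜) : pd i (fun y => -f y) x = -pd i f x := by
  unfold pd
  rw [fderiv_fun_neg]
  rfl

theorem pd_div {f g : (Fin N → ℝ) → ℝ} (hf : DifferentiableAt ℝ f x)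
    (hg : DifferentiableAt ℝ g x) (h0 : g x ≠ 0) :
    pd i (fun y => f y / g y) x = (pd i f x * g x - f x * pd i g x) / g x ^ 2 := by
  have h1 : pd i f x = pd i (fun y => f y / g y * g y) x := by
    refine pd_congr ?_
    filter_upwards [hg.continuousAt.eventually_ne h0] with y hy
    field_simp
  have h2 : DifferentiableAt ℝ (fun y => f y / g y) x := by
    simpa only [div_eq_mul_inv] using hf.fun_mul (hg.fun_inv h0)
  rw [pd_mul h2 hg] at h1
  rw [h1]
  field_simp
  ring

theorem pd_sum {ι : Type*} {s : Finset ι} {f : ι → (Fin N → ℝ) → 𝕜}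
    (hf : ∀ k ∈ s, DifferentiableAt ℝ (f k) x) :
    pd i (fun y => ∑ k ∈ s, f k y) x = ∑ k ∈ s, pd i (f k) x := by
  unfold pd
  rw [fderiv_fun_sum hf]
  simp

theorem pd_sum_mul {ι : Type*} [Fintype ι] {f g : ι → (Fin N → ℝ) → 𝕜}
    (hf : ∀ k, DifferentiableAt ℝ (f k) x) (hg : ∀ k, DifferentiableAt ℝ (g k) x) :
    pd i (fun y => ∑ k, f k y * g k y) x =
      ∑ k, (pd i (f k) x * g k x + f k x * pd i (g k) x) := by
  rw [pd_sum fun k _ => (hf k).fun_mul (hg k)]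
  exact Finset.sum_congr rfl fun k _ => pd_mul (hf k) (hg k)

theorem hasFDerivAt_comp_coord {q : ℝ → 𝕜} {q' : 𝕜} (hq : HasDerivAt q q' (x j)) :
    HasFDerivAt (fun y : Fin N → ℝ => q (y j))
      ((ContinuousLinearMap.toSpanSingleton ℝ q').comp
        (ContinuousLinearMap.proj (R := ℝ) (φ := fun _ : Fin N => ℝ) j)) x :=
  HasFDerivAt.comp x (f := fun y : Fin N → ℝ => y j) hq.hasFDerivAt (hasFDerivAt_apply j x)

theorem pd_comp_coord {q : ℝ → 𝕜} (hq : DifferentiableAt ℝ q (x j)) :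
    pd i (fun y => q (y j)) x = if i = j then deriv q (x j) else 0 := by
  unfold pd
  rw [(hasFDerivAt_comp_coord hq.hasDerivAt).fderiv]
  by_cases hij : i = j
  · subst hij; simp
  · simp [hij, Ne.symm hij]

theorem differentiableAt_comp_coord {q : ℝ → 𝕜} (hq : DifferentiableAt ℝ q (x j)) :
    DifferentiableAt ℝ (fun y : Fin N → ℝ => q (y j)) x :=
  (hasFDerivAt_comp_coord hq.hasDerivAt).differentiableAt

theorem contDiffOn_pd {f : (Fin N → ℝ) → 𝕜} {U : Set (Fin N → ℝ)} (hU : IsOpen U)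
    {m r : WithTop ℕ∞} (hf : ContDiffOn ℝ r f U) (hm : m + 1 ≤ r) :
    ContDiffOn ℝ m (pd i f) U :=
  (hf.fderiv_of_isOpen hU hm).clm_apply contDiffOn_const

/-- Mean value inequality along a segment, in terms of partial derivatives. -/
theorem norm_sub_le_of_segment {f : (Fin N → ℝ) → 𝕜} {B : Set (Fin N → ℝ)} (hB : Convex ℝ B)
    (hf : ∀ y ∈ B, DifferentiableAt ℝ f y) {x y : Fin N → ℝ} (hx : x ∈ B) (hy : y ∈ B) {C : ℝ}
    (hC : ∀ z ∈ B, ‖∑ j, (y j - x j) • pd j f z‖ ≤ C) : ‖f y - f x‖ ≤ C := by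
  have hz : ∀ t ∈ Set.Icc (0 : ℝ) 1, x + t • (y - x) ∈ B := fun t ht =>
    hB.add_smul_sub_mem hx hy ht
  have hderiv : ∀ t ∈ Set.Icc (0 : ℝ) 1, HasDerivAt (fun t : ℝ => f (x + t • (y - x)))
      (fderiv ℝ f (x + t • (y - x)) (y - x)) t := by
    intro t ht
    have h1 : HasDerivAt (fun t : ℝ => x + t • (y - x)) (y - x) t := by
      simpa using ((hasDerivAt_id t).smul_const (y - x)).const_add x
    exact (hf _ (hz t ht)).hasFDerivAt.comp_hasDerivAt t h1
  have := norm_image_sub_le_of_norm_deriv_le_segment_01' (C := C)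
    (fun t ht => (hderiv t ht).hasDerivWithinAt) (fun t ht => by
      rw [fderiv_apply_eq_sum_pd]
      exact hC _ (hz t ⟨ht.1, ht.2.le⟩))
  simpa using this

/-- The segment from `x` to `y` has no `i`-th component, so only derivatives known to be zero occur
along it. -/
theorem eq_of_pd_eq_zero {f : (Fin N → ℝ) → 𝕜} {B : Set (Fin N → ℝ)} (hB : Convex ℝ B)
    (hf : ∀ y ∈ B, DifferentiableAt ℝ f y) (h0 : ∀ y ∈ B, ∀ j, j ≠ i → pd j f y = 0)
    {x y : Fin N → ℝ} (hx : x ∈ B) (hy : y ∈ B) (hxy : x i = y i) : f x = f y := by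
  have := norm_sub_le_of_segment hB hf hx hy (C := 0) (fun z hz => by
    rw [Finset.sum_eq_zero, norm_zero]
    intro j _
    by_cases hj : j = i
    · subst hj; simp [hxy]
    · simp [h0 z hz j hj])
  exact (sub_eq_zero.1 (norm_le_zero_iff.1 this)).symm

end Pd

/-! ### Divisibility between quadratic polynomials in the momenta. -/

section Polynomial

open MvPolynomial

/-- The polynomial `∑ aₖ Xₖ² + b`. -/
noncomputable def quadPoly {N : ℕ} (a : Fin N → ℝ) (b : ℝ) : MvPolynomial (Fin N) ℝ :=
  ∑ k, C (a k) * X k ^ 2 + C b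

theorem eval_quadPoly {N : ℕ} (a : Fin N → ℝ) (b : ℝ) (p : Fin N → ℝ) :
    eval p (quadPoly a b) = ∑ k, a k * p k ^ 2 + b := by
  simp [quadPoly]

theorem coeff_quadPoly_two {N : ℕ} (a : Fin N → ℝ) (b : ℝ) (k : Fin N) :
    coeff (Finsupp.single k 2) (quadPoly a b) = a k := by
  classical
  simp only [quadPoly, coeff_add, coeff_sum, coeff_C_mul, coeff_C, coeff_X_pow]
  rw [Finset.sum_eq_single k]
  · simp [eq_comm]
  · intro j _ hj
    rw [if_neg, mul_zero]
    intro h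
    exact hj (Finsupp.single_left_injective two_ne_zero h)
  · simp

theorem coeff_quadPoly_zero {N : ℕ} (a : Fin N → ℝ) (b : ℝ) :
    coeff 0 (quadPoly a b) = b := by
  classical
  simp [quadPoly, coeff_sum, coeff_X_pow]

theorem totalDegree_quadPoly_le {N : ℕ} (a : Fin N → ℝ) (b : ℝ) :
    (quadPoly a b).totalDegree ≤ 2 := by
  refine (totalDegree_add _ _).trans (max_le ?_ (by simp))
  refine totalDegree_finsetSum_le fun k _ => ?_
  refine (totalDegree_mul _ _).trans ?_
  simp [totalDegree_X_pow]

/-- A quadratic polynomial that is a polynomial multiple of another one is a constant multiple. -/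
theorem exists_const_of_quad_eq_mul {N : ℕ} {a l : Fin N → ℝ} {b w : ℝ} (hl : l ≠ 0)
    (P : MvPolynomial (Fin N) ℝ)
    (hP : ∀ p : Fin N → ℝ, (∀ k, p k ≠ 0) →
      ∑ k, a k * p k ^ 2 + b = eval p P * (∑ k, l k * p k ^ 2 + w)) :
    ∃ c, (∀ k, a k = c * l k) ∧ b = c * w := by
  have hpoly : quadPoly a b = P * quadPoly l w := by
    -- Momenta without zero components form a product of infinite sets, which is enough to identify
    -- polynomials.
    refine funext_set (fun _ => {0}ᶜ) (fun _ => (Set.finite_singleton 0).infinite_compl)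
      fun p hp => ?_
    rw [map_mul, eval_quadPoly, eval_quadPoly]
    exact hP p fun k => hp k (Set.mem_univ k)
  have hc : ∃ c, P = C c := by
    obtain ⟨k, hk⟩ := Function.ne_iff.1 hl
    have hL : quadPoly l w ≠ 0 := fun h => hk (by
      rw [← coeff_quadPoly_two l w k, h]; simp)
    by_cases hP0 : P = 0
    · exact ⟨0, by simp [hP0]⟩
    have h2 : 2 ≤ (quadPoly l w).totalDegree := by
      have hmem : Finsupp.single k 2 ∈ (quadPoly l w).support := by
        rw [mem_support_iff, coeff_quadPoly_two]; exact hk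
      simpa using le_totalDegree hmem
    have h3 := totalDegree_quadPoly_le a b
    -- Degrees add over a domain: $\deg P+\deg L\le 2$ while $\deg L\ge 2$, so $P$ is constant.
    rw [hpoly, totalDegree_mul_of_isDomain hP0 hL] at h3
    exact ⟨_, totalDegree_eq_zero_iff_eq_C.1 (by omega)⟩
  obtain ⟨c, rfl⟩ := hc
  refine ⟨c, fun k => ?_, ?_⟩
  · rw [← coeff_quadPoly_two a b k, hpoly, coeff_C_mul, coeff_quadPoly_two]
  · rw [← coeff_quadPoly_zero a b, hpoly, coeff_C_mul, coeff_quadPoly_zero]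

end Polynomial

/-! ### Uniqueness for a linear Goursat problem. -/

section Goursat

variable {N : ℕ}

theorem update_mem_closedBall {x₀ x : Fin N → ℝ} {ε : ℝ} (hx : x ∈ Metric.closedBall x₀ ε)
    (i : Fin N) : Function.update x₀ i (x i) ∈ Metric.closedBall x₀ ε := by
  have hε : 0 ≤ ε := dist_nonneg.trans hx
  rw [Metric.mem_closedBall, dist_pi_le_iff hε] at hx ⊢
  intro j
  by_cases h : j = i
  · subst h; simpa using hx j
  · simpa [h] using hε

/-- Uniqueness for a Goursat problem on a small cube: if the partial derivatives of `G` and the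
partial derivatives `∂ⱼfᵢ`, `j ≠ i`, are linearly controlled by `G` and `f`, if `G` vanishes at the
center and each `fᵢ` vanishes on the `i`-th axis, then `G` and `f` vanish. -/
theorem goursat_eq_zero {x₀ : Fin N → ℝ} {ε K : ℝ} (hK : 0 ≤ K)
    (hsmall : N * ε * (3 * K) < 1) {G : (Fin N → ℝ) → ℝ} {f : Fin N → (Fin N → ℝ) → ℝ}
    (hG : ∀ x ∈ Metric.closedBall x₀ ε, DifferentiableAt ℝ G x)
    (hf : ∀ i, ∀ x ∈ Metric.closedBall x₀ ε, DifferentiableAt ℝ (f i) x)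
    (hdG : ∀ x ∈ Metric.closedBall x₀ ε, ∀ i, |pd i G x| ≤ K * (|G x| + |f i x|))
    (hdf : ∀ x ∈ Metric.closedBall x₀ ε, ∀ i j, i ≠ j →
      |pd j (f i) x| ≤ K * (|G x| + |f i x| + |f j x|))
    (hG0 : G x₀ = 0)
    (hf0 : ∀ x ∈ Metric.closedBall x₀ ε, ∀ i, f i (Function.update x₀ i (x i)) = 0) :
    ∀ x ∈ Metric.closedBall x₀ ε, G x = 0 ∧ ∀ i, f i x = 0 := by
  intro x hx
  have hε : 0 ≤ ε := dist_nonneg.trans hx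
  have hx₀ : x₀ ∈ Metric.closedBall x₀ ε := Metric.mem_closedBall_self hε
  let Φ : (Fin N → ℝ) → ℝ × (Fin N → ℝ) := fun y => (G y, fun i => f i y)
  have hΦ : ContinuousOn (fun y => ‖Φ y‖) (Metric.closedBall x₀ ε) := by
    refine ContinuousOn.norm (ContinuousOn.prodMk (fun y hy => ?_)
      (continuousOn_pi.2 fun i y hy => ?_))
    · exact (hG y hy).continuousAt.continuousWithinAt
    · exact (hf i y hy).continuousAt.continuousWithinAt
  -- `M` is the largest value over the cube of all $|G|$, $|f_i|$. Integrating the bounds from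
  -- points where the functions vanish gives `M ≤ N * ε * (3 * K) * M`, which forces `M = 0`. The 3
  -- counts the at most three terms in each derivative bound.
  obtain ⟨z, hz, hmax⟩ := (isCompact_closedBall x₀ ε).exists_isMaxOn ⟨x, hx⟩ hΦ
  set M := ‖Φ z‖ with hM
  have hM0 : 0 ≤ M := norm_nonneg _
  have hGM : ∀ y ∈ Metric.closedBall x₀ ε, |G y| ≤ M := fun y hy =>
    (norm_fst_le (Φ y)).trans (hmax hy)
  have hfM : ∀ y ∈ Metric.closedBall x₀ ε, ∀ i, |f i y| ≤ M := fun y hy i =>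
    ((norm_le_pi_norm (Φ y).2 i).trans (norm_snd_le (Φ y))).trans (hmax hy)
  have hcoord : ∀ y ∈ Metric.closedBall x₀ ε, ∀ j, |y j - x₀ j| ≤ ε := fun y hy j =>
    (dist_le_pi_dist y x₀ j).trans hy
  have hbound : ∀ (g : (Fin N → ℝ) → ℝ) (a y : Fin N → ℝ), a ∈ Metric.closedBall x₀ ε →
      y ∈ Metric.closedBall x₀ ε → (∀ w ∈ Metric.closedBall x₀ ε, DifferentiableAt ℝ g w) →
      (∀ w ∈ Metric.closedBall x₀ ε, ∀ j, |(y j - a j) * pd j g w| ≤ ε * (3 * K * M)) →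
      g a = 0 → |g y| ≤ N * ε * (3 * K) * M := by
    intro g a y ha hy hg hb h0
    have := norm_sub_le_of_segment (convex_closedBall x₀ ε) hg ha hy
      (C := N * ε * (3 * K) * M) (fun w hw => by
        refine (norm_sum_le _ _).trans ((Finset.sum_le_sum fun j _ => hb w hw j).trans_eq ?_)
        simp
        ring)
    simpa [h0] using this
  have h1 : |G z| ≤ N * ε * (3 * K) * M := by
    refine hbound G x₀ z hx₀ hz hG (fun w hw j => ?_) hG0
    rw [abs_mul]
    refine mul_le_mul (hcoord z hz j) ((hdG w hw j).trans ?_) (abs_nonneg _) hε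
    nlinarith [hGM w hw, hfM w hw j]
  have h2 : ∀ i, |f i z| ≤ N * ε * (3 * K) * M := by
    intro i
    refine hbound (f i) (Function.update x₀ i (z i)) z (update_mem_closedBall hz i) hz (hf i)
      (fun w hw j => ?_) (hf0 z hz i)
    by_cases hij : j = i
    -- The base point on the `i`-th axis shares its `i`-th coordinate with `z`, so $\partial_if_i$,
    -- about which nothing is assumed, does not enter.
    · subst hij
      simp only [Function.update_self, sub_self, zero_mul, abs_zero]
      positivity
    rw [abs_mul, Function.update_of_ne hij]
    refine mul_le_mul (hcoord z hz j) ((hdf w hw i j (Ne.symm hij)).trans ?_) (abs_nonneg _) hε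
    nlinarith [hGM w hw, hfM w hw j, hfM w hw i]
  have hle : M ≤ N * ε * (3 * K) * M := by
    rw [hM]
    refine max_le h1 ((pi_norm_le_iff_of_nonneg ?_).2 h2)
    positivity
  have hMz : M = 0 := by nlinarith
  exact ⟨abs_nonpos_iff.1 ((hGM x hx).trans_eq hMz),
    fun i => abs_nonpos_iff.1 ((hfM x hx i).trans_eq hMz)⟩

end Goursat

/-! ### Tangency and integrability as identities between coefficients. -/

section Relations

variable {N : ℕ} {U : Set (Fin N → ℝ)} {h l : Fin N → (Fin N → ℝ) → ℝ} {V W : (Fin N → ℝ) → ℝ}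
  {x p : Fin N → ℝ} {i j : Fin N}

theorem dx_quadFn {g : Fin N → (Fin N → ℝ) → ℝ} {G : (Fin N → ℝ) → ℝ}
    (hg : ∀ k, DifferentiableAt ℝ (g k) x) (hG : DifferentiableAt ℝ G x) :
    dx i (quadFn g G) x p = quadFn (fun k => pd i (g k)) (pd i G) x p := by
  unfold dx quadFn
  rw [pd_add (.fun_sum fun k _ => (hg k).mul_const _) hG, pd_sum fun k _ => (hg k).mul_const _]
  congr 1
  refine Finset.sum_congr rfl fun k _ => ?_
  rw [pd_mul (hg k) (differentiableAt_const _)]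
  simp

theorem dp_quadFn (g : Fin N → (Fin N → ℝ) → ℝ) (G : (Fin N → ℝ) → ℝ) :
    dp i (quadFn g G) x p = 2 * g i x * p i := by
  have hd : ∀ k, DifferentiableAt ℝ (fun q : Fin N → ℝ => q k ^ 2) p := fun k => by fun_prop
  have hsq : ∀ k, pd i (fun q : Fin N → ℝ => q k ^ 2) p = if i = k then 2 * p k else 0 := by
    intro k
    rw [pd_comp_coord (q := fun t => t ^ 2) (by fun_prop)]
    simp
  unfold dp
  change pd i (fun q : Fin N → ℝ => ∑ k, g k x * q k ^ 2 + G x) p = _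
  rw [pd_add (.fun_sum fun k _ => (hd k).const_mul _) (differentiableAt_const _),
    pd_sum fun k _ => (hd k).const_mul _, pd_const, add_zero,
    Finset.sum_congr rfl fun k _ => pd_const_mul _ (hd k)]
  simp [hsq]
  ring

theorem differentiableAt_quadFn {g : Fin N → (Fin N → ℝ) → ℝ} {G : (Fin N → ℝ) → ℝ}
    (hg : ∀ k, DifferentiableAt ℝ (g k) x) (hG : DifferentiableAt ℝ G x) :
    DifferentiableAt ℝ (fun y => quadFn g G y p) x :=
  (DifferentiableAt.fun_sum fun k _ => (hg k).mul_const _).fun_add hG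

theorem differentiableAt_quadFn_momenta (g : Fin N → (Fin N → ℝ) → ℝ) (G : (Fin N → ℝ) → ℝ) :
    DifferentiableAt ℝ (quadFn g G x) p := by
  change DifferentiableAt ℝ (fun q : Fin N → ℝ => ∑ k, g k x * q k ^ 2 + G x) p
  fun_prop

theorem coeffR_quadFn {g : Fin N → (Fin N → ℝ) → ℝ} {G : (Fin N → ℝ) → ℝ}
    (hg : ∀ k, DifferentiableAt ℝ (g k) x) (hG : DifferentiableAt ℝ G x) :
    coeffR (quadFn g G) i x p
      = -quadFn (fun k => pd i (g k)) (pd i G) x p / (2 * g i x * p i) := by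
  rw [coeffR, dx_quadFn hg hG, dp_quadFn]

theorem differentiableAt_of_contDiffOn {f : (Fin N → ℝ) → ℝ} (hU : IsOpen U) (hx : x ∈ U)
    (hf : ContDiffOn ℝ 2 f U) : DifferentiableAt ℝ f x :=
  (hf.differentiableOn two_ne_zero).differentiableAt (hU.mem_nhds hx)

theorem differentiableAt_pd {f : (Fin N → ℝ) → ℝ} (hU : IsOpen U) (hx : x ∈ U)
    (hf : ContDiffOn ℝ 2 f U) : DifferentiableAt ℝ (pd i f) x :=
  ((contDiffOn_pd hU hf (m := 1) (by norm_num)).differentiableOn one_ne_zero).differentiableAt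
    (hU.mem_nhds hx)

/-- The denominator $p_i$ of $R_i$ cancels against $\partial_{p_i}\mathcal L=2l_ip_i$, leaving a
quadratic polynomial in the momenta to compare with $\mathcal L$. -/
theorem vecD_quadFn_quadFn (hU : IsOpen U) (hx : x ∈ U)
    (hh : ∀ i, ContDiffOn ℝ 2 (h i) U) (hV : ContDiffOn ℝ 2 V U)
    (hl : ∀ i, ContDiffOn ℝ 2 (l i) U) (hW : ContDiffOn ℝ 2 W U)
    (hne : h i x ≠ 0) (hp : p i ≠ 0) :
    vecD (quadFn h V) i (quadFn l W) x p =
      ∑ k, (pd i (l k) x - l i x / h i x * pd i (h k) x) * p k ^ 2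
        + (pd i W x - l i x / h i x * pd i V x) := by
  have dh := fun k => differentiableAt_of_contDiffOn hU hx (hh k)
  have dl := fun k => differentiableAt_of_contDiffOn hU hx (hl k)
  have dV := differentiableAt_of_contDiffOn hU hx hV
  have dW := differentiableAt_of_contDiffOn hU hx hW
  rw [vecD, dx_quadFn dl dW, coeffR_quadFn dh dV, dp_quadFn]
  have : -quadFn (fun k => pd i (h k)) (pd i V) x p / (2 * h i x * p i) * (2 * l i x * p i)
      = -(l i x / h i x * quadFn (fun k => pd i (h k)) (pd i V) x p) := by
    field_simp
  rw [this]
  unfold quadFn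
  simp only [sub_mul, Finset.sum_sub_distrib, mul_add, Finset.mul_sum, mul_assoc]
  ring

/-- Since $i\ne j$, $\partial_{p_i}$ meets only the numerator of $R_j$ and produces a factor $p_i$,
which cancels the denominator of $R_i$. The factor $p_j$ cancels that of $R_j$, so again a quadratic
polynomial remains. -/
theorem mul_vecD_coeffR_quadFn (hU : IsOpen U) (hx : x ∈ U)
    (hh : ∀ i, ContDiffOn ℝ 2 (h i) U) (hV : ContDiffOn ℝ 2 V U)
    (hne : ∀ i, h i x ≠ 0) (hp : ∀ k, p k ≠ 0) (hij : i ≠ j) :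
    p j * vecD (quadFn h V) i (coeffR (quadFn h V) j) x p =
      -(∑ k, (pd i (pd j (h k)) x - pd j (h k) x * (pd i (h j) x / h j x)
          - pd i (h k) x * (pd j (h i) x / h i x)) * p k ^ 2
        + (pd i (pd j V) x - pd j V x * (pd i (h j) x / h j x)
          - pd i V x * (pd j (h i) x / h i x))) / (2 * h j x) := by
  have dh := fun k => differentiableAt_of_contDiffOn hU hx (hh k)
  have dV := differentiableAt_of_contDiffOn hU hx hV
  have dh2 := fun k => differentiableAt_pd (i := j) hU hx (hh k)
  have dV2 := differentiableAt_pd (i := j) hU hx hV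
  have hji : j ≠ i := hij.symm
  have h1 : dx i (coeffR (quadFn h V) j) x p =
      -(quadFn (fun k => pd i (pd j (h k))) (pd i (pd j V)) x p * h j x
        - quadFn (fun k => pd j (h k)) (pd j V) x p * pd i (h j) x)
        / (2 * h j x ^ 2 * p j) := by
    unfold dx
    have e1 : pd i (fun y => coeffR (quadFn h V) j y p) x =
        pd i (fun y => -(quadFn (fun k => pd j (h k)) (pd j V) y p / (2 * p j * h j y))) x := by
      refine pd_congr_of_isOpen hU hx fun y hy => ?_
      rw [coeffR_quadFn (fun k => differentiableAt_of_contDiffOn hU hy (hh k))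
        (differentiableAt_of_contDiffOn hU hy hV)]
      ring
    rw [e1, pd_neg, pd_div (differentiableAt_quadFn dh2 dV2) ((dh j).const_mul _)
      (mul_ne_zero (mul_ne_zero two_ne_zero (hp j)) (hne j)), pd_const_mul _ (dh j)]
    have e2 := dx_quadFn (i := i) (p := p) dh2 dV2
    unfold dx at e2
    rw [e2]
    have := hp j
    have := hne j
    field_simp
  have h2 : dp i (coeffR (quadFn h V) j) x p = -(pd j (h i) x * p i) / (h j x * p j) := by
    unfold dp
    have e1 : pd i (coeffR (quadFn h V) j x) p =
        pd i (fun q => -(quadFn (fun k => pd j (h k)) (pd j V) x q / (2 * h j x * q j))) p := by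
      congr 1
      funext q
      rw [coeffR_quadFn dh dV]
      ring
    have e2 : pd i (fun q : Fin N → ℝ => q j) p = 0 := by
      rw [pd_comp_coord (q := fun t => t) (by fun_prop), if_neg hij]
    rw [e1, pd_neg, pd_div (differentiableAt_quadFn_momenta _ _) (by fun_prop)
      (mul_ne_zero (mul_ne_zero two_ne_zero (hne j)) (hp j)), pd_const_mul _ (by fun_prop), e2]
    have e3 := dp_quadFn (x := x) (p := p) (i := i) (fun k => pd j (h k)) (pd j V)
    unfold dp at e3
    rw [e3]
    have := hp j
    have := hne j
    field_simp
    ring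
  have hQ : ∑ k, (pd i (pd j (h k)) x - pd j (h k) x * (pd i (h j) x / h j x)
          - pd i (h k) x * (pd j (h i) x / h i x)) * p k ^ 2
        + (pd i (pd j V) x - pd j V x * (pd i (h j) x / h j x)
          - pd i V x * (pd j (h i) x / h i x))
      = quadFn (fun k => pd i (pd j (h k))) (pd i (pd j V)) x p
        - quadFn (fun k => pd j (h k)) (pd j V) x p * (pd i (h j) x / h j x)
        - quadFn (fun k => pd i (h k)) (pd i V) x p * (pd j (h i) x / h i x) := by
    unfold quadFn
    simp only [sub_mul, Finset.sum_sub_distrib, add_mul, Finset.sum_mul, mul_right_comm]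
    ring
  rw [hQ, vecD, h1, h2, coeffR_quadFn dh dV]
  have := hp j
  have := hp i
  have := hne j
  have := hne i
  field_simp
  ring

theorem MaximalNonregularSeparation.l_ne_zero (hsep : MaximalNonregularSeparation U h V l W)
    (hx : x ∈ U) : (fun k => l k x) ≠ 0 :=
  (hsep.independent x hx).ne_zero 1

/-- Coefficientwise form of the tangency condition. -/
theorem MaximalNonregularSeparation.exists_tangent
    (hsep : MaximalNonregularSeparation U h V l W) (hU : IsOpen U) (hx : x ∈ U)
    (hh : ∀ i, ContDiffOn ℝ 2 (h i) U) (hV : ContDiffOn ℝ 2 V U)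
    (hl : ∀ i, ContDiffOn ℝ 2 (l i) U) (hW : ContDiffOn ℝ 2 W U)
    (hne : ∀ i, ∀ x ∈ U, h i x ≠ 0) (i : Fin N) :
    ∃ c, (∀ k, pd i (l k) x - l i x / h i x * pd i (h k) x = c * l k x) ∧
      pd i W x - l i x / h i x * pd i V x = c * W x := by
  obtain ⟨P, hP⟩ := hsep.tangent i x hx
  refine exists_const_of_quad_eq_mul (hsep.l_ne_zero hx) P fun p hp => ?_
  rw [← vecD_quadFn_quadFn hU hx hh hV hl hW (hne i x hx) (hp i)]
  exact hP p hp

/-- Coefficientwise form of the integrability condition. -/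
theorem MaximalNonregularSeparation.exists_integrable
    (hsep : MaximalNonregularSeparation U h V l W) (hU : IsOpen U) (hx : x ∈ U)
    (hh : ∀ i, ContDiffOn ℝ 2 (h i) U) (hV : ContDiffOn ℝ 2 V U)
    (hne : ∀ i, ∀ x ∈ U, h i x ≠ 0) (hij : i ≠ j) :
    ∃ c, (∀ k, pd i (pd j (h k)) x - pd j (h k) x * (pd i (h j) x / h j x)
          - pd i (h k) x * (pd j (h i) x / h i x) = c * l k x) ∧
      pd i (pd j V) x - pd j V x * (pd i (h j) x / h j x)
          - pd i V x * (pd j (h i) x / h i x) = c * W x := by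
  obtain ⟨P, hP⟩ := hsep.integrable i j hij x hx
  refine exists_const_of_quad_eq_mul (hsep.l_ne_zero hx)
    -- The constant removes the denominator $-2h_j$ in `mul_vecD_coeffR_quadFn`.
    (MvPolynomial.C (-(2 * h j x)) * P) fun p hp => ?_
  have h1 := hP p hp
  simp only at h1
  rw [mul_vecD_coeffR_quadFn hU hx hh hV (fun i => hne i x hx) hp hij,
    div_eq_iff (mul_ne_zero two_ne_zero (hne j x hx))] at h1
  rw [← neg_inj, h1, map_mul, MvPolynomial.eval_C]
  unfold quadFn
  ring

/-- If a continuous family of vectors is pointwise proportional to a nowhere vanishing one, then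
the factor is locally bounded. -/
theorem exists_bound_of_proportional (hU : IsOpen U) (hx : x ∈ U) {α : Fin N → (Fin N → ℝ) → ℝ}
    (hα : ∀ k, ContinuousOn (α k) U) (hl : ∀ k, ContinuousOn (l k) U)
    (hl0 : (fun k => l k x) ≠ 0) :
    ∃ K, ∀ᶠ y in nhds x, ∀ c, (∀ k, α k y = c * l k y) → |c| ≤ K := by
  -- Where a component $l_k$ is nonzero the factor must equal $\alpha_k/l_k$, which is continuous.
  -- Hence the factors, obtained separately at each point, are bounded although no regularity in the
  -- point was asked of them.
  obtain ⟨k, hk⟩ := Function.ne_iff.1 hl0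
  have hk : l k x ≠ 0 := hk
  have hlk : ContinuousAt (l k) x := (hl k).continuousAt (hU.mem_nhds hx)
  have hc : ContinuousAt (fun y => |α k y / l k y|) x :=
    (((hα k).continuousAt (hU.mem_nhds hx)).div hlk hk).abs
  refine ⟨|α k x / l k x| + 1, ?_⟩
  filter_upwards [hc.eventually_lt continuousAt_const (lt_add_one _), hlk.eventually_ne hk]
    with y hy hy0 c hcy
  rw [hcy k, mul_div_cancel_right₀ _ hy0] at hy
  exact hy.le

end Relations

/-! ### Separated solutions from data on the axes. -/

section Propagation

variable {N : ℕ} {U : Set (Fin N → ℝ)} {h l : Fin N → (Fin N → ℝ) → ℝ} {V W : (Fin N → ℝ) → ℝ}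
  {x : Fin N → ℝ} {i j : Fin N}

/-- The function `∑ gₖ(x) qₖ(xᵏ) + κ G(x)`. -/
def sepSum (g : Fin N → (Fin N → ℝ) → ℝ) (G : (Fin N → ℝ) → ℝ) (κ : ℝ) (q : Fin N → ℝ → ℝ)
    (x : Fin N → ℝ) : ℝ :=
  ∑ k, g k x * q k (x k) + κ * G x

theorem differentiableAt_sepSum {g : Fin N → (Fin N → ℝ) → ℝ} {G : (Fin N → ℝ) → ℝ} {κ : ℝ}
    {q : Fin N → ℝ → ℝ} (hg : ∀ k, DifferentiableAt ℝ (g k) x) (hG : DifferentiableAt ℝ G x)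
    (hq : ∀ k, DifferentiableAt ℝ (q k) (x k)) : DifferentiableAt ℝ (sepSum g G κ q) x :=
  (DifferentiableAt.fun_sum fun k _ =>
    (hg k).fun_mul (differentiableAt_comp_coord (hq k))).fun_add (hG.const_mul κ)

theorem pd_sepSum {g : Fin N → (Fin N → ℝ) → ℝ} {G : (Fin N → ℝ) → ℝ} {κ : ℝ}
    {q : Fin N → ℝ → ℝ} (hg : ∀ k, DifferentiableAt ℝ (g k) x) (hG : DifferentiableAt ℝ G x)
    (hq : ∀ k, DifferentiableAt ℝ (q k) (x k)) :
    pd i (sepSum g G κ q) x =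
      sepSum (fun k => pd i (g k)) (pd i G) κ q x + g i x * deriv (q i) (x i) := by
  have hQ := fun k => differentiableAt_comp_coord (hq k)
  unfold sepSum
  rw [pd_add (DifferentiableAt.fun_sum fun k _ => (hg k).fun_mul (hQ k)) (hG.const_mul κ),
    pd_sum_mul hg hQ, pd_const_mul κ hG, Finset.sum_add_distrib]
  simp only [pd_comp_coord (hq _), mul_ite, mul_zero, Finset.sum_ite_eq, Finset.mem_univ, if_true]
  ring

theorem sepSum_lincomb (a b c : ℝ) (g₁ g₂ g₃ : Fin N → (Fin N → ℝ) → ℝ)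
    (G₁ G₂ G₃ : (Fin N → ℝ) → ℝ) {g : Fin N → (Fin N → ℝ) → ℝ} {G : (Fin N → ℝ) → ℝ} (κ : ℝ)
    (q : Fin N → ℝ → ℝ) (hg : ∀ k, g k x = a * g₁ k x + b * g₂ k x + c * g₃ k x)
    (hG : G x = a * G₁ x + b * G₂ x + c * G₃ x) :
    sepSum g G κ q x = a * sepSum g₁ G₁ κ q x + b * sepSum g₂ G₂ κ q x + c * sepSum g₃ G₃ κ q x := by
  unfold sepSum
  simp only [hg, hG, mul_add, Finset.mul_sum, add_mul, Finset.sum_add_distrib, mul_assoc]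
  ring

variable (h V) in
/-- The separated function with value `q₀ᵢ` at `x₀ⁱ` for which `∑ hⱼ qⱼ + κ V` is constant on the
`i`-th coordinate axis through `x₀`, the other `qⱼ` being fixed. -/
noncomputable def axisFn (x₀ : Fin N → ℝ) (κ : ℝ) (q₀ : Fin N → ℝ) (i : Fin N) (t : ℝ) : ℝ :=
  q₀ i + (sepSum h V κ (fun k _ => q₀ k) x₀
    - sepSum h V κ (fun k _ => q₀ k) (Function.update x₀ i t)) / h i (Function.update x₀ i t)

theorem axisFn_self (x₀ : Fin N → ℝ) (κ : ℝ) (q₀ : Fin N → ℝ) (i : Fin N) :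
    axisFn h V x₀ κ q₀ i (x₀ i) = q₀ i := by
  simp [axisFn]

theorem contDiff_update (x₀ : Fin N → ℝ) (i : Fin N) (r : WithTop ℕ∞) :
    ContDiff ℝ r (fun t : ℝ => Function.update x₀ i t) := by
  rw [contDiff_pi]
  intro j
  by_cases hj : j = i
  · subst hj; simpa using contDiff_fun_id
  · simpa [hj] using contDiff_const

/-- The formula is rational in restrictions of `h` and `V` to an axis, with nonvanishing
denominator; no derivative is lost and analyticity is kept. -/
theorem contDiffOn_axisFn {r : WithTop ℕ∞} (hh : ∀ i, ContDiffOn ℝ r (h i) U)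
    (hV : ContDiffOn ℝ r V U) (hne : ∀ i, ∀ x ∈ U, h i x ≠ 0) (x₀ : Fin N → ℝ) (κ : ℝ)
    (q₀ : Fin N → ℝ) (i : Fin N) :
    ContDiffOn ℝ r (axisFn h V x₀ κ q₀ i) {t | Function.update x₀ i t ∈ U} := by
  have hm : Set.MapsTo (fun t : ℝ => Function.update x₀ i t) {t | Function.update x₀ i t ∈ U} U :=
    fun t ht => ht
  have hu := (contDiff_update x₀ i r).contDiffOn (s := {t | Function.update x₀ i t ∈ U})
  have hS : ContDiffOn ℝ r (sepSum h V κ (fun k _ => q₀ k)) U :=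
    (ContDiffOn.sum fun k _ => (hh k).mul contDiffOn_const).add (contDiffOn_const.mul hV)
  exact contDiffOn_const.add ((contDiffOn_const.sub (hS.comp hu hm)).div ((hh i).comp hu hm)
    fun t ht => hne i _ ht)

/-- On the `i`-th axis the other separated functions sit at their central values, so constancy of
the sum is one linear equation in the single unknown $q_i$. -/
theorem sepSum_axisFn (x₀ : Fin N → ℝ) (κ : ℝ) (q₀ : Fin N → ℝ) (i : Fin N) (t : ℝ)
    (hne : h i (Function.update x₀ i t) ≠ 0) :
    sepSum h V κ (axisFn h V x₀ κ q₀) (Function.update x₀ i t) =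
      sepSum h V κ (fun k _ => q₀ k) x₀ := by
  have : ∀ k, h k (Function.update x₀ i t)
      * axisFn h V x₀ κ q₀ k (Function.update x₀ i t k)
      = h k (Function.update x₀ i t) * q₀ k
        + if k = i then sepSum h V κ (fun k _ => q₀ k) x₀
          - sepSum h V κ (fun k _ => q₀ k) (Function.update x₀ i t) else 0 := by
    intro k
    by_cases hk : k = i
    · subst hk
      rw [Function.update_self, axisFn, if_pos rfl]
      field_simp
    · rw [Function.update_of_ne hk, axisFn_self, if_neg hk, add_zero]
  rw [sepSum, Finset.sum_congr rfl fun k _ => this k, Finset.sum_add_distrib,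
    Finset.sum_ite_eq' Finset.univ i, if_pos (Finset.mem_univ i)]
  simp only [sepSum]
  ring

theorem exists_uniform_bound {ι X : Type*} [Finite ι] {F : Filter X} {P : ι → ℝ → X → Prop}
    (hmono : ∀ i a b y, a ≤ b → P i a y → P i b y) (hP : ∀ i, ∃ K, ∀ᶠ y in F, P i K y) :
    ∃ K, ∀ᶠ y in F, ∀ i, P i K y := by
  choose K hK using hP
  obtain ⟨M, hM⟩ := Finite.exists_le K
  exact ⟨M, Filter.eventually_all.2 fun i => (hK i).mono fun y hy => hmono i _ _ y (hM i) hy⟩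

theorem exists_bound_of_continuousOn (hU : IsOpen U) (hx : x ∈ U) {f : (Fin N → ℝ) → ℝ}
    (hf : ContinuousOn f U) : ∃ K, ∀ᶠ y in nhds x, |f y| ≤ K := by
  refine ⟨|f x| + 1, ?_⟩
  have hc := (hf.continuousAt (hU.mem_nhds hx)).abs
  filter_upwards [hc.eventually_lt continuousAt_const (lt_add_one _)] with y hy using hy.le

/-- Near `x₀`, the factors in the coefficientwise tangency and integrability conditions, and the
other coefficients of the differential system for separated functions, have a common bound. -/
theorem MaximalNonregularSeparation.exists_coeff_bound
    (hsep : MaximalNonregularSeparation U h V l W) (hU : IsOpen U) (hx : x ∈ U)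
    (hh : ∀ i, ContDiffOn ℝ 2 (h i) U) (hl : ∀ i, ContDiffOn ℝ 2 (l i) U)
    (hne : ∀ i, ∀ x ∈ U, h i x ≠ 0) :
    ∃ K, 0 ≤ K ∧ ∀ᶠ y in nhds x,
      (∀ i, |l i y / h i y| ≤ K) ∧ (∀ i j, |pd j (h i) y / h i y| ≤ K) ∧
      (∀ i c, (∀ k, pd i (l k) y - l i y / h i y * pd i (h k) y = c * l k y) → |c| ≤ K) ∧
      (∀ i j c, (∀ k, pd i (pd j (h k)) y - pd j (h k) y * (pd i (h j) y / h j y)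
          - pd i (h k) y * (pd j (h i) y / h i y) = c * l k y) → |c| ≤ K) := by
  have ch : ∀ k, ContinuousOn (h k) U := fun k => (hh k).continuousOn
  have cl : ∀ k, ContinuousOn (l k) U := fun k => (hl k).continuousOn
  have cph : ∀ i k, ContinuousOn (pd i (h k)) U := fun i k =>
    (contDiffOn_pd hU (hh k) (m := 1) (by norm_num)).continuousOn
  have cpl : ∀ i k, ContinuousOn (pd i (l k)) U := fun i k =>
    (contDiffOn_pd hU (hl k) (m := 1) (by norm_num)).continuousOn
  have cpph : ∀ i j k, ContinuousOn (pd i (pd j (h k))) U := fun i j k =>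
    (contDiffOn_pd hU (contDiffOn_pd hU (hh k) (m := 1) (by norm_num)) (m := 0)
      (by norm_num)).continuousOn
  have clh : ∀ i, ContinuousOn (fun y => l i y / h i y) U := fun i => (cl i).div (ch i) (hne i)
  have cphh : ∀ i j k, ContinuousOn (fun y => pd i (h j) y / h k y) U := fun i j k =>
    (cph i j).div (ch k) (hne k)
  have hl0 := hsep.l_ne_zero hx
  obtain ⟨K₁, h₁⟩ := exists_uniform_bound
    (P := fun (i : Fin N) K y => |l i y / h i y| ≤ K) (fun i a b y hab hy => hy.trans hab)
    fun i => exists_bound_of_continuousOn hU hx (clh i)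
  obtain ⟨K₂, h₂⟩ := exists_uniform_bound
    (P := fun (ij : Fin N × Fin N) K y => |pd ij.2 (h ij.1) y / h ij.1 y| ≤ K)
    (fun i a b y hab hy => hy.trans hab)
    fun ij => exists_bound_of_continuousOn hU hx (cphh ij.2 ij.1 ij.1)
  obtain ⟨K₃, h₃⟩ := exists_uniform_bound
    (P := fun (i : Fin N) K y => ∀ c,
      (∀ k, pd i (l k) y - l i y / h i y * pd i (h k) y = c * l k y) → |c| ≤ K)
    (fun i a b y hab hy c hc => (hy c hc).trans hab)
    fun i => exists_bound_of_proportional hU hx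
      (fun k => (cpl i k).sub ((clh i).mul (cph i k))) cl hl0
  obtain ⟨K₄, h₄⟩ := exists_uniform_bound
    (P := fun (ij : Fin N × Fin N) K y => ∀ c,
      (∀ k, pd ij.1 (pd ij.2 (h k)) y - pd ij.2 (h k) y * (pd ij.1 (h ij.2) y / h ij.2 y)
          - pd ij.1 (h k) y * (pd ij.2 (h ij.1) y / h ij.1 y) = c * l k y) → |c| ≤ K)
    (fun i a b y hab hy c hc => (hy c hc).trans hab)
    fun ij => exists_bound_of_proportional hU hx
      (fun k => ((cpph ij.1 ij.2 k).sub ((cph ij.2 k).mul (cphh ij.1 ij.2 ij.2))).sub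
        ((cph ij.1 k).mul (cphh ij.2 ij.1 ij.1))) cl hl0
  refine ⟨max 0 (max (max K₁ K₂) (max K₃ K₄)), le_max_left _ _, ?_⟩
  filter_upwards [h₁, h₂, h₃, h₄] with y a₁ a₂ a₃ a₄
  refine ⟨fun i => (a₁ i).trans ?_, fun i j => (a₂ (i, j)).trans ?_,
    fun i c hc => (a₃ i c hc).trans ?_, fun i j c hc => (a₄ (i, j) c hc).trans ?_⟩ <;> simp

/-- Separated functions constructed on the axes satisfy the Hamilton-Jacobi equation and the side
condition on a whole cube, if they satisfy the side condition at the center. -/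
theorem MaximalNonregularSeparation.exists_propagation
    (hsep : MaximalNonregularSeparation U h V l W) (hU : IsOpen U) {x₀ : Fin N → ℝ} (hx₀ : x₀ ∈ U)
    (hh : ∀ i, ContDiffOn ℝ 2 (h i) U) (hV : ContDiffOn ℝ 2 V U)
    (hl : ∀ i, ContDiffOn ℝ 2 (l i) U) (hW : ContDiffOn ℝ 2 W U)
    (hne : ∀ i, ∀ x ∈ U, h i x ≠ 0) :
    ∃ ε > 0, Metric.closedBall x₀ ε ⊆ U ∧ ∀ (κ : ℝ) (q₀ : Fin N → ℝ),
      sepSum l W κ (fun k _ => q₀ k) x₀ = 0 → ∀ x ∈ Metric.closedBall x₀ ε,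
        sepSum h V κ (axisFn h V x₀ κ q₀) x = sepSum h V κ (fun k _ => q₀ k) x₀ ∧
        sepSum l W κ (axisFn h V x₀ κ q₀) x = 0 := by
  obtain ⟨K, hK0, hK⟩ := hsep.exists_coeff_bound hU hx₀ hh hl hne
  obtain ⟨δ, hδ, hδB⟩ := Metric.eventually_nhds_iff_ball.1 (hK.and (hU.mem_nhds hx₀))
  obtain ⟨ε, hε, hεδ, hsmall⟩ : ∃ ε > 0, ε < δ ∧ N * ε * (3 * K) < 1 := by
    -- The second bound gives $N\varepsilon\cdot 3K\le NK\cdot 3/(2(3NK+1))<1$, as `goursat_eq_zero`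
    -- requires. The first keeps the closed cube inside the open one, so derivatives exist on its
    -- boundary too. Neither involves `κ` or `q₀`.
    refine ⟨min (δ / 2) (1 / (2 * (N * (3 * K) + 1))), by positivity, ?_, ?_⟩
    · exact (min_le_left _ _).trans_lt (half_lt_self hδ)
    · have h0 : 0 ≤ N * (3 * K) := by positivity
      calc N * min (δ / 2) (1 / (2 * (N * (3 * K) + 1))) * (3 * K)
          = N * (3 * K) * min (δ / 2) (1 / (2 * (N * (3 * K) + 1))) := by ring
        _ ≤ N * (3 * K) * (1 / (2 * (N * (3 * K) + 1))) :=
            mul_le_mul_of_nonneg_left (min_le_right _ _) h0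
        _ < 1 := by
            rw [mul_one_div, div_lt_one (by positivity)]
            linarith
  have hball : ∀ x ∈ Metric.closedBall x₀ ε, x ∈ Metric.ball x₀ δ := fun x hx =>
    Metric.closedBall_subset_ball hεδ hx
  have hBU : ∀ x ∈ Metric.ball x₀ δ, x ∈ U := fun x hx => (hδB x hx).2
  have hupd : ∀ x ∈ Metric.ball x₀ δ, ∀ i, Function.update x₀ i (x i) ∈ U := fun x hx i =>
    hBU _ (Metric.mem_ball.2 (lt_of_le_of_lt
      (update_mem_closedBall (Metric.mem_closedBall.2 le_rfl) i) hx))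
  refine ⟨ε, hε, fun x hx => hBU x (hball x hx), fun κ q₀ hq₀ => ?_⟩
  set q := axisFn h V x₀ κ q₀ with hqdef
  have hTopen : ∀ i, IsOpen {t : ℝ | Function.update x₀ i t ∈ U} := fun i =>
    hU.preimage (contDiff_update x₀ i 0).continuous
  have hqC : ∀ i, ContDiffOn ℝ 2 (q i) {t | Function.update x₀ i t ∈ U} :=
    fun i => contDiffOn_axisFn hh hV hne x₀ κ q₀ i
  have hqd : ∀ x ∈ Metric.ball x₀ δ, ∀ i, DifferentiableAt ℝ (q i) (x i) := fun x hx i =>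
    ((hqC i).differentiableOn two_ne_zero).differentiableAt
      ((hTopen i).mem_nhds (hupd x hx i))
  have hqd2 : ∀ x ∈ Metric.ball x₀ δ, ∀ i, DifferentiableAt ℝ (deriv (q i)) (x i) := fun x hx i =>
    (((hqC i).deriv_of_isOpen (hTopen i) (m := 1) (by norm_num)).differentiableOn
      one_ne_zero).differentiableAt ((hTopen i).mem_nhds (hupd x hx i))
  have dh := fun x hx k => differentiableAt_of_contDiffOn hU (hBU x hx) (hh k)
  have dl := fun x hx k => differentiableAt_of_contDiffOn hU (hBU x hx) (hl k)
  have dV := fun x hx => differentiableAt_of_contDiffOn hU (hBU x hx) hV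
  have dW := fun x hx => differentiableAt_of_contDiffOn hU (hBU x hx) hW
  have dh2 := fun x hx i k => differentiableAt_pd (i := i) hU (hBU x hx) (hh k)
  have dV2 := fun x hx i => differentiableAt_pd (i := i) hU (hBU x hx) hV
  have hFd : ∀ x ∈ Metric.ball x₀ δ, DifferentiableAt ℝ (sepSum h V κ q) x := fun x hx =>
    differentiableAt_sepSum (dh x hx) (dV x hx) (hqd x hx)
  have hpF : ∀ i, ∀ x ∈ Metric.ball x₀ δ, pd i (sepSum h V κ q) x =
      sepSum (fun k => pd i (h k)) (pd i V) κ q x + h i x * deriv (q i) (x i) := fun i x hx =>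
    pd_sepSum (dh x hx) (dV x hx) (hqd x hx)
  have hpFd : ∀ i, ∀ x ∈ Metric.ball x₀ δ, DifferentiableAt ℝ (pd i (sepSum h V κ q)) x := by
    intro i x hx
    refine DifferentiableAt.congr_of_eventuallyEq ?_
      (Filter.eventually_of_mem (Metric.isOpen_ball.mem_nhds hx) (hpF i))
    exact (differentiableAt_sepSum (dh2 x hx i) (dV2 x hx i) (hqd x hx)).fun_add
      ((dh x hx i).fun_mul (differentiableAt_comp_coord (hqd2 x hx i)))
  have hppF : ∀ i j, i ≠ j → ∀ x ∈ Metric.ball x₀ δ, pd j (pd i (sepSum h V κ q)) x =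
      sepSum (fun k => pd j (pd i (h k))) (pd j (pd i V)) κ q x
        + pd i (h j) x * deriv (q j) (x j) + pd j (h i) x * deriv (q i) (x i) := by
    intro i j hij x hx
    rw [pd_congr_of_isOpen Metric.isOpen_ball hx (hpF i),
      pd_add (differentiableAt_sepSum (dh2 x hx i) (dV2 x hx i) (hqd x hx))
        ((dh x hx i).fun_mul (differentiableAt_comp_coord (hqd2 x hx i))),
      pd_sepSum (dh2 x hx i) (dV2 x hx i) (hqd x hx),
      pd_mul (dh x hx i) (differentiableAt_comp_coord (hqd2 x hx i)),
      pd_comp_coord (hqd2 x hx i), if_neg hij.symm]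
    ring
  -- The unknowns are $G$ and the first derivatives $f_i=\partial_iF$.
  have hgoursat := goursat_eq_zero (x₀ := x₀) hK0 hsmall (G := sepSum l W κ q)
    (f := fun i => pd i (sepSum h V κ q))
    (fun x hx => differentiableAt_sepSum (dl x (hball x hx)) (dW x (hball x hx))
      (hqd x (hball x hx)))
    (fun i x hx => hpFd i x (hball x hx))
    (by
      intro x hx i
      have hx' := hball x hx
      obtain ⟨c, hc, hcW⟩ := hsep.exists_tangent hU (hBU x hx') hh hV hl hW hne i
      have hcK := (hδB x hx').1.2.2.1 i c hc
      have hρK := (hδB x hx').1.1 i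
      -- The derivative $q_i'$ occurs as $l_iq_i'$ in $\partial_iG$ and as $h_iq_i'$ in
      -- $\partial_iF$; the ratio $l_i/h_i$ eliminates it, and tangency turns the rest into a
      -- multiple of $G$.
      have e : pd i (sepSum l W κ q) x
          = c * sepSum l W κ q x + l i x / h i x * pd i (sepSum h V κ q) x := by
        rw [pd_sepSum (dl x hx') (dW x hx') (hqd x hx'), hpF i x hx',
          sepSum_lincomb c (l i x / h i x) 0 l (fun k => pd i (h k)) (fun k => pd i (h k)) W
            (pd i V) (pd i V) κ q (fun k => by linarith [hc k]) (by linarith)]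
        have := hne i x (hBU x hx')
        field_simp
        ring
      rw [e, mul_add]
      refine (abs_add_le _ _).trans (add_le_add ?_ ?_) <;> rw [abs_mul] <;> gcongr)
    (by
      intro x hx i j hij
      have hx' := hball x hx
      obtain ⟨c, hc, hcV⟩ := hsep.exists_integrable hU (hBU x hx') hh hV hne hij.symm
      have hcK := (hδB x hx').1.2.2.2 j i c hc
      have h1 := (hδB x hx').1.2.1 i j
      have h2 := (hδB x hx').1.2.1 j i
      -- Here $q_i'$ and $q_j'$ are eliminated through $\partial_iF$ and $\partial_jF$;
      -- integrability turns the remainder into a multiple of $G$.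
      have e : pd j (pd i (sepSum h V κ q)) x
          = c * sepSum l W κ q x + pd j (h i) x / h i x * pd i (sepSum h V κ q) x
            + pd i (h j) x / h j x * pd j (sepSum h V κ q) x := by
        rw [hppF i j hij x hx', hpF i x hx', hpF j x hx',
          sepSum_lincomb c (pd j (h i) x / h i x) (pd i (h j) x / h j x) l (fun k => pd i (h k))
            (fun k => pd j (h k)) W (pd i V) (pd j V) κ q
            (fun k => by linarith [hc k]) (by linarith)]
        have := hne i x (hBU x hx')
        have := hne j x (hBU x hx')
        field_simp
        ring
      rw [e, mul_add, mul_add]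
      refine (abs_add_le _ _).trans (add_le_add ((abs_add_le _ _).trans (add_le_add ?_ ?_)) ?_) <;>
        rw [abs_mul] <;> gcongr)
    (by
      rw [← hq₀]
      simp only [sepSum, hqdef, axisFn_self])
    (by
      intro x hx i
      have hu := update_mem_closedBall hx i
      -- By construction $F$ is constant along the `i`-th axis, so its tangential derivative there
      -- is zero.
      have h1 : HasDerivAt (fun t : ℝ => Function.update x₀ i t) (Pi.single i 1) (x i) :=
        hasDerivAt_update x₀ i (x i)
      have h2 := (hFd _ (hball _ hu)).hasFDerivAt.comp_hasDerivAt (x i) h1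
      have h3 : (sepSum h V κ q ∘ fun t : ℝ => Function.update x₀ i t) =ᶠ[nhds (x i)]
          fun _ => sepSum h V κ (fun k _ => q₀ k) x₀ := by
        filter_upwards [(hTopen i).mem_nhds (hupd x (hball x hx) i)] with t ht
        exact sepSum_axisFn x₀ κ q₀ i t (hne i _ ht)
      exact h2.unique ((hasDerivAt_const _ _).congr_of_eventuallyEq h3))
  intro x hx
  refine ⟨?_, (hgoursat x hx).1⟩
  have hconst := norm_sub_le_of_segment (convex_closedBall x₀ ε)
    (fun y hy => hFd y (hball y hy)) (Metric.mem_closedBall_self hε.le) hx (C := 0) (fun z hz => by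
      simp [(hgoursat z hz).2])
  rw [sub_eq_zero.1 (norm_le_zero_iff.1 hconst)]
  simp only [sepSum, hqdef, axisFn_self]

end Propagation

/-! ### Dual vectors and a basis adapted to the pair $h,l$. -/

section LinearAlgebra

variable {N : ℕ}

/-- The combination of `h` and `l` orthogonal to `h` whose product with `l` is `1`. -/
noncomputable def dualVec (h l : Fin N → ℝ) (i : Fin N) : ℝ :=
  ((∑ k, h k * h k) * l i - (∑ k, h k * l k) * h i) /
    ((∑ k, h k * h k) * (∑ k, l k * l k) - (∑ k, h k * l k) * (∑ k, h k * l k))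

/-- This is the equality case of Cauchy–Schwarz for the Euclidean product on coefficient vectors, so
the signs of the $h_i$ play no role. -/
theorem gram_ne_zero {h l : Fin N → ℝ} (hhl : LinearIndependent ℝ ![h, l]) :
    (∑ k, h k * h k) * (∑ k, l k * l k) - (∑ k, h k * l k) * (∑ k, h k * l k) ≠ 0 := by
  intro h0
  rw [LinearIndependent.pair_iff] at hhl
  -- The squared length of $(h\cdot l)h-(h\cdot h)l$ is $h\cdot h$ times the Gram determinant.
  have hw : ∑ k, ((∑ k, h k * l k) * h k + -(∑ k, h k * h k) * l k) ^ 2 = 0 := by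
    have : ∀ a b : ℝ, ∑ k, (a * h k + b * l k) ^ 2
        = a ^ 2 * (∑ k, h k * h k) + 2 * a * b * (∑ k, h k * l k) + b ^ 2 * ∑ k, l k * l k := by
      intro a b
      simp only [Finset.mul_sum, ← Finset.sum_add_distrib]
      exact Finset.sum_congr rfl fun k _ => by ring
    rw [this]
    linear_combination (∑ k, h k * h k) * h0
  rw [Finset.sum_eq_zero_iff_of_nonneg fun k _ => sq_nonneg _] at hw
  have h1 := (hhl (∑ k, h k * l k) (-(∑ k, h k * h k)) (by
    ext k
    simpa using hw k (Finset.mem_univ k))).2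
  rw [neg_eq_zero, Finset.sum_eq_zero_iff_of_nonneg fun k _ => mul_self_nonneg _] at h1
  have h2 := (hhl 1 0 (by
    ext k
    simpa using h1 k (Finset.mem_univ k))).1
  exact one_ne_zero h2

theorem sum_mul_dualVec_eq_div (g h l : Fin N → ℝ) : ∑ i, g i * dualVec h l i =
    ((∑ k, h k * h k) * (∑ k, g k * l k) - (∑ k, h k * l k) * (∑ k, g k * h k)) /
    ((∑ k, h k * h k) * (∑ k, l k * l k) - (∑ k, h k * l k) * (∑ k, h k * l k)) := by
  simp only [dualVec, mul_div_assoc']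
  rw [← Finset.sum_div]
  congr 1
  rw [Finset.mul_sum, Finset.mul_sum, ← Finset.sum_sub_distrib]
  exact Finset.sum_congr rfl fun k _ => by ring

theorem sum_mul_dualVec_self (h l : Fin N → ℝ) : ∑ i, h i * dualVec h l i = 0 := by
  rw [sum_mul_dualVec_eq_div, mul_comm, sub_self, zero_div]

theorem sum_mul_dualVec {h l : Fin N → ℝ} (hhl : LinearIndependent ℝ ![h, l]) :
    ∑ i, l i * dualVec h l i = 1 := by
  rw [sum_mul_dualVec_eq_div, Finset.sum_congr rfl fun k _ => mul_comm (l k) (h k),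
    div_self (gram_ne_zero hhl)]

/-- A basis of the vectors orthogonal to `l`, adapted to `h`. -/
theorem exists_adapted_basis {n : ℕ} {h l : Fin (n + 2) → ℝ}
    (hhl : LinearIndependent ℝ ![h, l]) :
    ∃ s : Fin (n + 1) → Fin (n + 2) → ℝ, LinearIndependent ℝ s ∧
      (∀ ξ, ∑ i, h i * s ξ i = if ξ = 0 then 1 else 0) ∧ ∀ ξ, ∑ i, l i * s ξ i = 0 := by
  have hlh : LinearIndependent ℝ ![l, h] := LinearIndependent.pair_symm_iff.1 hhl
  let φ : (Fin (n + 2) → ℝ) →ₗ[ℝ] ℝ × ℝ :=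
    ((∑ i, h i • LinearMap.proj i : (Fin (n + 2) → ℝ) →ₗ[ℝ] ℝ)).prod
      (∑ i, l i • LinearMap.proj i)
  have hφ : ∀ q, φ q = (∑ i, h i * q i, ∑ i, l i * q i) := fun q => by
    simp [φ]
  have hsurj : Function.Surjective φ := by
    rintro ⟨a, b⟩
    refine ⟨a • dualVec l h + b • dualVec h l, ?_⟩
    rw [map_add, map_smul, map_smul, hφ, hφ, sum_mul_dualVec hhl, sum_mul_dualVec hlh,
      sum_mul_dualVec_self, sum_mul_dualVec_self]
    simp
  have hrank : Module.finrank ℝ (LinearMap.ker φ) = n := by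
    have h1 := φ.finrank_range_add_finrank_ker
    rw [LinearMap.range_eq_top.2 hsurj, finrank_top, Module.finrank_prod, Module.finrank_self,
      Module.finrank_fin_fun] at h1
    omega
  let b := Module.finBasisOfFinrankEq ℝ (LinearMap.ker φ) hrank
  have hb : ∀ ξ, φ (b ξ) = 0 := fun ξ => LinearMap.mem_ker.1 (b ξ).2
  have hb1 : ∀ ξ, ∑ i, h i * (b ξ : Fin (n + 2) → ℝ) i = 0 := fun ξ => by
    have := hb ξ; rw [hφ] at this; exact congrArg Prod.fst this
  have hb2 : ∀ ξ, ∑ i, l i * (b ξ : Fin (n + 2) → ℝ) i = 0 := fun ξ => by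
    have := hb ξ; rw [hφ] at this; exact congrArg Prod.snd this
  -- The kernel of $q\mapsto(h\cdot q,l\cdot q)$ supplies $n$ vectors. `dualVec l h` completes them
  -- inside $l^\perp$ and lies outside the kernel because its product with $h$ is 1; it comes first,
  -- matching the energy constant.
  refine ⟨Fin.cons (dualVec l h) fun ξ => b ξ, ?_, fun ξ => ?_, fun ξ => ?_⟩
  · rw [linearIndependent_finCons]
    refine ⟨b.linearIndependent.map' (LinearMap.ker φ).subtype (Submodule.ker_subtype _),
      fun hmem => ?_⟩
    have hle : Submodule.span ℝ (Set.range fun ξ => (b ξ : Fin (n + 2) → ℝ)) ≤ LinearMap.ker φ :=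
      Submodule.span_le.2 (by rintro _ ⟨ξ, rfl⟩; exact (b ξ).2)
    have h0 := LinearMap.mem_ker.1 (hle hmem)
    rw [hφ, sum_mul_dualVec hlh] at h0
    exact one_ne_zero (congrArg Prod.fst h0)
  · refine Fin.cases ?_ (fun ξ => ?_) ξ
    · simpa using sum_mul_dualVec hlh
    · simpa using hb1 ξ
  · refine Fin.cases ?_ (fun ξ => ?_) ξ
    · simpa using sum_mul_dualVec_self l h
    · simpa using hb2 ξ

end LinearAlgebra

/-! ### Generalized Stäckel matrices and their separation equations. -/

section Stackel

variable {n : ℕ} {s : Fin (n + 2) → Fin (n + 1) → ℝ → ℝ}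
  {a : Fin (n + 2) → (Fin (n + 2) → ℝ) → ℝ} {v : Fin (n + 2) → ℝ → ℝ}
  {x x₀ : Fin (n + 2) → ℝ} {ε : ℝ}

@[simp]
theorem stackelMatrix_castSucc (i : Fin (n + 2)) (ξ : Fin (n + 1)) :
    stackelMatrix s a x i ξ.castSucc = s i ξ (x i) := by
  simp [stackelMatrix]

@[simp]
theorem stackelMatrix_last (i : Fin (n + 2)) :
    stackelMatrix s a x i (Fin.last (n + 1)) = a i x := by
  simp [stackelMatrix]

/-- In a relation between the columns, pairing with `l` isolates the coefficient of the last one;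
independence of the others then finishes. -/
theorem stackelMatrix_det_ne_zero_of_linearIndependent {l : Fin (n + 2) → ℝ}
    (hs : LinearIndependent ℝ fun ξ => fun i => s i ξ (x i))
    (hls : ∀ ξ, ∑ i, l i * s i ξ (x i) = 0) (hla : ∑ i, l i * a i x = 1) :
    (stackelMatrix s a x).det ≠ 0 := by
  rw [Ne, ← Matrix.exists_mulVec_eq_zero_iff]
  rintro ⟨c, hc0, hc⟩
  have hrow : ∀ i, ∑ ξ : Fin (n + 1), s i ξ (x i) * c ξ.castSucc + a i x * c (Fin.last _) = 0 := by
    intro i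
    have := congrFun hc i
    simpa [Matrix.mulVec, dotProduct, Fin.sum_univ_castSucc] using this
  have hlast : c (Fin.last (n + 1)) = 0 := by
    have h1 : ∑ i, l i * (∑ ξ : Fin (n + 1), s i ξ (x i) * c ξ.castSucc
        + a i x * c (Fin.last _)) = c (Fin.last _) := by
      simp only [mul_add, Finset.sum_add_distrib, Finset.mul_sum, ← mul_assoc]
      rw [Finset.sum_comm, ← Finset.sum_mul, hla, one_mul, Finset.sum_eq_zero, zero_add]
      intro ξ _
      rw [← Finset.sum_mul, hls, zero_mul]
    rw [← h1]
    simp [hrow]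
  have hcs := Fintype.linearIndependent_iff.1 hs (fun ξ => c ξ.castSucc) (by
    ext i
    have := hrow i
    simp only [hlast, mul_zero, add_zero] at this
    simpa [mul_comm] using this)
  refine hc0 (funext fun k => ?_)
  refine Fin.lastCases hlast (fun ξ => hcs ξ) k

theorem stackelMatrix_inv_row {g : Fin (n + 2) → ℝ} {k : Fin (n + 2)}
    (hdet : (stackelMatrix s a x).det ≠ 0)
    (hg : ∀ m, ∑ i, g i * stackelMatrix s a x i m = if m = k then 1 else 0) (j : Fin (n + 2)) :
    (stackelMatrix s a x)⁻¹ k j = g j := by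
  have hu : IsUnit (stackelMatrix s a x).det := isUnit_iff_ne_zero.2 hdet
  have h1 : Matrix.vecMul g (stackelMatrix s a x) = Pi.single k 1 := by
    ext m
    rw [Pi.single_apply, ← hg m]
    rfl
  have h2 : Matrix.vecMul (Matrix.vecMul g (stackelMatrix s a x)) (stackelMatrix s a x)⁻¹ = g := by
    rw [Matrix.vecMul_vecMul, Matrix.mul_nonsing_inv _ hu, Matrix.vecMul_one]
  rw [h1, Matrix.single_one_vecMul] at h2
  exact congrFun h2 j

theorem sum_stackelMatrix_mul_sum_inv {𝕜 : Type*} [RCLike 𝕜]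
    (hdet : (stackelMatrix s a x).det ≠ 0) (y : Fin (n + 2) → 𝕜) (i : Fin (n + 2)) :
    ∑ k, ((stackelMatrix s a x i k : ℝ) : 𝕜) * ∑ j, (((stackelMatrix s a x)⁻¹ k j : ℝ) : 𝕜) * y j
      = y i := by
  have h1 := Matrix.mul_nonsing_inv _ (isUnit_iff_ne_zero.2 hdet)
  have h2 : ∀ j, ∑ k, ((stackelMatrix s a x i k : ℝ) : 𝕜) * (((stackelMatrix s a x)⁻¹ k j : ℝ) : 𝕜)
      = if i = j then 1 else 0 := by
    intro j
    have := congrFun (congrFun h1 i) j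
    rw [Matrix.mul_apply, Matrix.one_apply] at this
    have h3 := congrArg (fun t : ℝ => (t : 𝕜)) this
    simp only [RCLike.ofReal_sum, RCLike.ofReal_mul] at h3
    rw [h3]
    split_ifs <;> simp
  simp only [Finset.mul_sum, ← mul_assoc]
  rw [Finset.sum_comm]
  simp only [← Finset.sum_mul, h2]
  simp

theorem sum_inv_mul_sum_stackelMatrix {𝕜 : Type*} [RCLike 𝕜]
    (hdet : (stackelMatrix s a x).det ≠ 0) (y : Fin (n + 2) → 𝕜) (i : Fin (n + 2)) :
    ∑ k, (((stackelMatrix s a x)⁻¹ i k : ℝ) : 𝕜) * ∑ j, ((stackelMatrix s a x k j : ℝ) : 𝕜) * y j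
      = y i := by
  have h1 := Matrix.nonsing_inv_mul _ (isUnit_iff_ne_zero.2 hdet)
  have h2 : ∀ j, ∑ k, (((stackelMatrix s a x)⁻¹ i k : ℝ) : 𝕜) * ((stackelMatrix s a x k j : ℝ) : 𝕜)
      = if i = j then 1 else 0 := by
    intro j
    have := congrFun (congrFun h1 i) j
    rw [Matrix.mul_apply, Matrix.one_apply] at this
    have h3 := congrArg (fun t : ℝ => (t : 𝕜)) this
    simp only [RCLike.ofReal_sum, RCLike.ofReal_mul] at h3
    rw [h3]
    split_ifs <;> simp
  simp only [Finset.mul_sum, ← mul_assoc]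
  rw [Finset.sum_comm]
  simp only [← Finset.sum_mul, h2]
  simp

/-- Passing from the center to `x` one coordinate at a time never leaves the cube. -/
theorem eq_of_coordinatewise_eq {α : Type*} {N : ℕ} {x₁ : Fin N → ℝ} {δ : ℝ}
    {f : (Fin N → ℝ) → α}
    (hf : ∀ x ∈ Metric.ball x₁ δ, ∀ y ∈ Metric.ball x₁ δ, ∀ j, (∀ i, i ≠ j → x i = y i) →
      f x = f y) {x : Fin N → ℝ} (hx : x ∈ Metric.ball x₁ δ) : f x = f x₁ := by
  classical
  have hδ : 0 < δ := dist_nonneg.trans_lt hx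
  have hmem : ∀ A : Finset (Fin N), A.piecewise x x₁ ∈ Metric.ball x₁ δ := by
    intro A
    rw [Metric.mem_ball, dist_pi_lt_iff hδ] at hx ⊢
    intro i
    by_cases hi : i ∈ A
    · simpa [hi] using hx i
    · simpa [hi] using hδ
  have key : ∀ A : Finset (Fin N), f (A.piecewise x x₁) = f x₁ := by
    intro A
    induction A using Finset.induction_on with
    | empty => simp
    | insert j A hj ih =>
      rw [← ih]
      refine hf _ (hmem _) _ (hmem _) j fun i hij => ?_
      by_cases hi : i ∈ A <;> simp [Finset.piecewise, hi, hij]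
  simpa using key Finset.univ

/-- The separation equations of a generalized Stäckel matrix govern the separated solutions of the
Hamilton-Jacobi equation with side condition. -/
theorem sepEqsGoverns {𝕜 : Type*} [RCLike 𝕜] {h l : Fin (n + 2) → (Fin (n + 2) → ℝ) → ℝ}
    {V W : (Fin (n + 2) → ℝ) → ℝ}
    (hne : ∀ i, ∀ x ∈ Metric.ball x₀ ε, h i x ≠ 0)
    (hdet : ∀ x ∈ Metric.ball x₀ ε, (stackelMatrix s a x).det ≠ 0)
    (hfirst : ∀ x ∈ Metric.ball x₀ ε, (∀ j, (stackelMatrix s a x)⁻¹ 0 j = h j x) ∧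
      V x = ∑ j, v j (x j) * (stackelMatrix s a x)⁻¹ 0 j)
    (hlast : ∀ x ∈ Metric.ball x₀ ε, (∀ j, (stackelMatrix s a x)⁻¹ (Fin.last (n + 1)) j = l j x) ∧
      W x = ∑ j, v j (x j) * (stackelMatrix s a x)⁻¹ (Fin.last (n + 1)) j) :
    SepEqsGoverns 𝕜 x₀ ε h V l W s v := by
  intro x₁ δ hδ hsub E u hu
  let y : (Fin (n + 2) → ℝ) → Fin (n + 2) → 𝕜 := fun x j => pd j u x ^ 2 + (v j (x j) : 𝕜)
  let c : (Fin (n + 2) → ℝ) → Fin (n + 2) → 𝕜 := fun x k =>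
    ∑ j, (((stackelMatrix s a x)⁻¹ k j : ℝ) : 𝕜) * y x j
  have hc0 : ∀ x ∈ Metric.ball x₁ δ, ∑ i, (h i x : 𝕜) * pd i u x ^ 2 + (V x : 𝕜) = c x 0 := by
    intro x hx
    obtain ⟨h1, h2⟩ := hfirst x (hsub hx)
    simp only [c, y, h2, h1, mul_add, Finset.sum_add_distrib]
    push_cast
    congr 1
    exact Finset.sum_congr rfl fun j _ => mul_comm _ _
  have hcl : ∀ x ∈ Metric.ball x₁ δ, ∑ i, (l i x : 𝕜) * pd i u x ^ 2 + (W x : 𝕜)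
      = c x (Fin.last (n + 1)) := by
    intro x hx
    obtain ⟨h1, h2⟩ := hlast x (hsub hx)
    simp only [c, y, h2, h1, mul_add, Finset.sum_add_distrib]
    push_cast
    congr 1
    exact Finset.sum_congr rfl fun j _ => mul_comm _ _
  constructor
  · rintro ⟨hH, hL⟩
    have hy : ∀ x ∈ Metric.ball x₁ δ, ∀ i,
        ∑ ξ : Fin (n + 1), (s i ξ (x i) : 𝕜) * c x ξ.castSucc = y x i := by
      intro x hx i
      have h1 := sum_stackelMatrix_mul_sum_inv (hdet x (hsub hx)) (y x) i
      have h2 : c x (Fin.last (n + 1)) = 0 := (hcl x hx).symm.trans (hL x hx)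
      rw [Fin.sum_univ_castSucc] at h1
      change _ + _ * c x (Fin.last (n + 1)) = _ at h1
      rw [h2, mul_zero, add_zero] at h1
      simpa using h1
    have hE : ∀ x ∈ Metric.ball x₁ δ, c x 0 = E := fun x hx => (hc0 x hx).symm.trans (hH x hx)
    have hyc : ∀ x ∈ Metric.ball x₁ δ, ∀ z ∈ Metric.ball x₁ δ, ∀ i, x i = z i → y x i = y z i := by
      intro x hx z hz i hxz
      have h1 : pd i u x = pd i u z := by
        refine eq_of_pd_eq_zero (i := i) (convex_ball x₁ δ) (fun w hw => ?_)
          (fun w hw j hj => hu.2 w hw i j hj.symm) hx hz hxz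
        exact ((contDiffOn_pd Metric.isOpen_ball hu.1 (m := 1) (by norm_num)).differentiableOn
          one_ne_zero).differentiableAt (Metric.isOpen_ball.mem_nhds hw)
      simp only [y, h1, hxz]
    have hconst : ∀ x ∈ Metric.ball x₁ δ, (fun ξ : Fin (n + 1) => c x ξ.castSucc)
        = fun ξ : Fin (n + 1) => c x₁ ξ.castSucc := by
      intro x hx
      refine eq_of_coordinatewise_eq (f := fun x => fun ξ : Fin (n + 1) => c x ξ.castSucc)
        (fun x hx z hz j hxz => ?_) hx
      -- Suppose `x` and `z` differ only in coordinate `j`, and let `d` be the change of the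
      -- constants, with last entry 0 by the side condition. This zero suppresses the column `a`,
      -- which depends on all coordinates. In rows `i ≠ j` both the `s` entries and `y` are
      -- unchanged, so $w=S(x)d$ can be nonzero only in row `j`.
      let d : Fin (n + 2) → 𝕜 := Fin.snoc (α := fun _ => 𝕜)
        (fun ξ : Fin (n + 1) => c x ξ.castSucc - c z ξ.castSucc) 0
      let w : Fin (n + 2) → 𝕜 := fun i => ∑ k, ((stackelMatrix s a x i k : ℝ) : 𝕜) * d k
      have hd : ∀ k, ∑ i, (((stackelMatrix s a x)⁻¹ k i : ℝ) : 𝕜) * w i = d k := fun k =>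
        sum_inv_mul_sum_stackelMatrix (hdet x (hsub hx)) d k
      have hw : ∀ i, w i = ∑ ξ : Fin (n + 1), (s i ξ (x i) : 𝕜) * c x ξ.castSucc
          - ∑ ξ : Fin (n + 1), (s i ξ (x i) : 𝕜) * c z ξ.castSucc := by
        intro i
        simp [w, d, Fin.sum_univ_castSucc, mul_sub]
      have hwi : ∀ i, i ≠ j → w i = 0 := by
        intro i hij
        have hzi := hy z hz i
        rw [← hxz i hij] at hzi
        rw [hw, hy x hx i, hzi, hyc x hx z hz i (hxz i hij), sub_self]
      -- The energy is the same at both points, so $0=d_0=T^{0j}w_j=h_jw_j$ with $h_j\ne0$. This is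
      -- where the nonvanishing of every $H_j^{-2}$ is needed.
      have hwj : w j = 0 := by
        have h1 := hd 0
        rw [Finset.sum_eq_single j (fun i _ hij => by rw [hwi i hij, mul_zero]) (by simp),
          (hfirst x (hsub hx)).1 j] at h1
        have h2 : d 0 = 0 := by
          change d (Fin.castSucc 0) = 0
          simp only [d, Fin.snoc_castSucc]
          rw [Fin.castSucc_zero, hE x hx, hE z hz, sub_self]
        rw [h2] at h1
        exact (mul_eq_zero.1 h1).resolve_left
          (RCLike.ofReal_ne_zero.2 (hne j x (hsub hx)))
      have hw0 : ∀ i, w i = 0 := fun i => by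
        by_cases hij : i = j
        · rw [hij, hwj]
        · exact hwi i hij
      funext ξ
      have h1 := hd ξ.castSucc
      simp only [hw0, mul_zero, Finset.sum_const_zero, d, Fin.snoc_castSucc] at h1
      exact sub_eq_zero.1 h1.symm
    refine ⟨fun ξ => -c x₁ ξ.castSucc, ?_, fun x hx i => ?_⟩
    · change -c x₁ (Fin.castSucc 0) = -E
      rw [Fin.castSucc_zero, hE x₁ (Metric.mem_ball_self hδ)]
    · have h1 := hy x hx i
      have h2 : ∀ ξ : Fin (n + 1), c x ξ.castSucc = c x₁ ξ.castSucc :=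
        fun ξ => congrFun (hconst x hx) ξ
      simp only [h2, y] at h1
      simp only [sepTerm, mul_neg, Finset.sum_neg_distrib, h1]
      ring
  · rintro ⟨b, hb0, hb⟩
    have hcb : ∀ x ∈ Metric.ball x₁ δ, ∀ k,
        c x k = Fin.snoc (α := fun _ => 𝕜) (fun ξ => -b ξ) 0 k := by
      intro x hx k
      rw [← sum_inv_mul_sum_stackelMatrix (hdet x (hsub hx))
        (Fin.snoc (α := fun _ => 𝕜) (fun ξ => -b ξ) 0) k]
      refine Finset.sum_congr rfl fun i _ => ?_
      congr 1
      have h1 := hb x hx i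
      simp only [sepTerm] at h1
      rw [Fin.sum_univ_castSucc]
      simp only [Fin.snoc_castSucc, Fin.snoc_last, stackelMatrix_castSucc, mul_neg, Finset.sum_neg_distrib, mul_zero, add_zero, y]
      linear_combination h1
    refine ⟨fun x hx => ?_, fun x hx => ?_⟩
    · rw [hc0 x hx, hcb x hx]
      change Fin.snoc (α := fun _ => 𝕜) (fun ξ => -b ξ) 0 (Fin.castSucc 0) = E
      rw [Fin.snoc_castSucc, hb0, neg_neg]
    · rw [hcl x hx, hcb x hx, Fin.snoc_last]

end Stackel

/-! ### Existence of separated solutions away from turning points. -/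

section Solutions

/-- A nonzero value allows a smooth local branch of $\sqrt{-g}$, which is then integrated; an
identically zero `g` allows the zero function. -/
theorem exists_sqrt_primitive {g : ℝ → ℂ} {I : Set ℝ} (hI : IsOpen I) (hg : ContDiffOn ℝ 2 g I)
    {t₀ : ℝ} (ht₀ : t₀ ∈ I) (h0 : g t₀ ≠ 0 ∨ ∀ t ∈ I, g t = 0) :
    ∃ δ > 0, ∃ φ w : ℝ → ℂ, ContDiffOn ℝ 2 w (Set.Ioo (t₀ - δ) (t₀ + δ)) ∧
      ∀ t ∈ Set.Ioo (t₀ - δ) (t₀ + δ), HasDerivAt w (φ t) t ∧ φ t ^ 2 + g t = 0 := by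
  rcases h0 with h0 | h0
  · have hc : ContinuousAt (fun t => g t / g t₀) t₀ :=
      (hg.continuousOn.continuousAt (hI.mem_nhds ht₀)).div_const _
    have hmem : ∀ᶠ t in nhds t₀, t ∈ I ∧ g t / g t₀ ∈ Complex.slitPlane := by
      refine Filter.Eventually.and (hI.mem_nhds ht₀)
        (hc.eventually_mem (Complex.isOpen_slitPlane.mem_nhds ?_))
      simp [div_self h0]
    obtain ⟨δ, hδ, hδI⟩ := Metric.eventually_nhds_iff_ball.1 hmem
    rw [Real.ball_eq_Ioo] at hδI
    set J := Set.Ioo (t₀ - δ) (t₀ + δ)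
    have ht₀J : t₀ ∈ J := ⟨by linarith, by linarith⟩
    -- Normalizing by `g t₀` keeps the quotient near 1, within the domain of the principal
    -- logarithm, whatever the argument of `g t₀`.
    let φ : ℝ → ℂ := fun t =>
      Complex.exp (Complex.log (-g t₀) / 2) * Complex.exp (Complex.log (g t / g t₀) / 2)
    have hφ : ContDiffOn ℝ 2 φ J := by
      have h1 : ContDiffOn ℝ 2 (fun t => Complex.log (g t / g t₀)) J := fun t ht =>
        ContDiffAt.comp_contDiffWithinAt (f := fun t => g t / g t₀) t
          ((Complex.contDiffAt_log (hδI t ht).2).restrict_scalars ℝ)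
          (((hg.mono fun t ht => (hδI t ht).1).div_const (g t₀)) t ht)
      exact contDiffOn_const.mul (h1.div_const 2).cexp
    have hderiv : ∀ t ∈ J, HasDerivAt (fun t => ∫ τ in t₀..t, φ τ) (φ t) t := by
      intro t ht
      refine intervalIntegral.integral_hasDerivAt_right ?_ ?_ ?_
      · exact (hφ.continuousOn.mono (Set.ordConnected_Ioo.uIcc_subset ht₀J ht)).intervalIntegrable
      · exact hφ.continuousOn.stronglyMeasurableAtFilter isOpen_Ioo t ht
      · exact hφ.continuousOn.continuousAt (isOpen_Ioo.mem_nhds ht)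
    refine ⟨δ, hδ, φ, fun t => ∫ τ in t₀..t, φ τ, ?_, fun t ht => ⟨hderiv t ht, ?_⟩⟩
    · have h1 := contDiffOn_succ_iff_deriv_of_isOpen (𝕜 := ℝ) (n := 1)
        (f := fun t => ∫ τ in t₀..t, φ τ) (s := J) isOpen_Ioo
      rw [one_add_one_eq_two] at h1
      refine h1.2 ⟨fun t ht => (hderiv t ht).differentiableAt.differentiableWithinAt, by simp, ?_⟩
      exact (hφ.of_le one_le_two).congr fun t ht => (hderiv t ht).deriv
    · have hne : g t / g t₀ ≠ 0 := Complex.slitPlane_ne_zero (hδI t ht).2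
      have hsq : ∀ z : ℂ, z ≠ 0 → Complex.exp (Complex.log z / 2) ^ 2 = z := by
        intro z hz
        rw [← Complex.exp_nat_mul]
        push_cast
        rw [mul_div_cancel₀ _ two_ne_zero, Complex.exp_log hz]
      simp only [φ, mul_pow]
      rw [hsq _ (neg_ne_zero.2 h0), hsq _ hne]
      field_simp
      ring
  · obtain ⟨δ, hδ, hδI⟩ := Metric.isOpen_iff.1 hI t₀ ht₀
    rw [Real.ball_eq_Ioo] at hδI
    refine ⟨δ, hδ, 0, 0, contDiffOn_const, fun t ht => ⟨hasDerivAt_const _ _, ?_⟩⟩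
    simp [h0 t (hδI ht)]

variable {n : ℕ} {s : Fin (n + 2) → Fin (n + 1) → ℝ → ℝ}
  {a : Fin (n + 2) → (Fin (n + 2) → ℝ) → ℝ} {v : Fin (n + 2) → ℝ → ℝ}
  {x x₀ : Fin (n + 2) → ℝ} {ε : ℝ} {r : WithTop ℕ∞}

theorem apply_mem_Ioo_of_mem_ball {N : ℕ} {x x₀ : Fin N → ℝ} {ε : ℝ}
    (hx : x ∈ Metric.ball x₀ ε) (i : Fin N) : x i ∈ Set.Ioo (x₀ i - ε) (x₀ i + ε) := by
  rw [← Real.ball_eq_Ioo]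
  exact (dist_le_pi_dist x x₀ i).trans_lt hx

theorem exists_separated_solution
    (hs : ∀ i ξ, ContDiffOn ℝ 2 (s i ξ) (Set.Ioo (x₀ i - ε) (x₀ i + ε)))
    (hv : ∀ i, ContDiffOn ℝ 2 (v i) (Set.Ioo (x₀ i - ε) (x₀ i + ε)))
    (c : Fin (n + 1) → ℂ) {x₁ : Fin (n + 2) → ℝ} (hx₁ : x₁ ∈ Metric.ball x₀ ε)
    (hc : ∀ i, sepTerm s v c i (x₁ i) ≠ 0 ∨
      ∀ t ∈ Set.Ioo (x₀ i - ε) (x₀ i + ε), sepTerm s v c i t = 0) :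
    ∃ δ > 0, Metric.ball x₁ δ ⊆ Metric.ball x₀ ε ∧
      ∃ u : (Fin (n + 2) → ℝ) → ℂ, IsSeparated (Metric.ball x₁ δ) u ∧
        SolvesSepEqs (Metric.ball x₁ δ) s v c u := by
  have hg : ∀ i, ContDiffOn ℝ 2 (sepTerm s v c i) (Set.Ioo (x₀ i - ε) (x₀ i + ε)) := by
    intro i
    have hcast : ∀ f : ℝ → ℝ, ContDiffOn ℝ 2 f (Set.Ioo (x₀ i - ε) (x₀ i + ε)) →
        ContDiffOn ℝ 2 (fun t => ((f t : ℝ) : ℂ)) (Set.Ioo (x₀ i - ε) (x₀ i + ε)) :=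
      fun f hf => Complex.ofRealCLM.contDiff.comp_contDiffOn hf
    exact (hcast _ (hv i)).add
      (ContDiffOn.sum fun ξ _ => (hcast _ (hs i ξ)).mul contDiffOn_const)
  choose δ hδ φ w hw hφ using fun i =>
    exists_sqrt_primitive isOpen_Ioo (hg i) (apply_mem_Ioo_of_mem_ball hx₁ i) (hc i)
  obtain ⟨i₀, hi₀⟩ := Finite.exists_min δ
  obtain ⟨δ', hδ', hsub⟩ := Metric.isOpen_iff.1 Metric.isOpen_ball x₁ hx₁
  have hmem : ∀ x ∈ Metric.ball x₁ (min (δ i₀) δ'), ∀ i,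
      x i ∈ Set.Ioo (x₁ i - δ i) (x₁ i + δ i) := fun x hx i =>
    apply_mem_Ioo_of_mem_ball
      (Metric.ball_subset_ball ((min_le_left _ _).trans (hi₀ i)) hx) i
  have hpd : ∀ x ∈ Metric.ball x₁ (min (δ i₀) δ'), ∀ i, pd i (fun x => ∑ k, w k (x k)) x
      = φ i (x i) := by
    intro x hx i
    have hd := fun k => (hφ k (x k) (hmem x hx k)).1
    rw [pd_sum fun k _ => differentiableAt_comp_coord (hd k).differentiableAt,
      Finset.sum_congr rfl fun k _ => pd_comp_coord (hd k).differentiableAt]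
    simp [(hd i).deriv]
  refine ⟨min (δ i₀) δ', lt_min (hδ i₀) hδ', fun x hx => hsub
    (Metric.ball_subset_ball (min_le_right _ _) hx), fun x => ∑ k, w k (x k), ⟨?_, ?_⟩, ?_⟩
  · exact ContDiffOn.sum fun k _ => (hw k).comp (contDiff_apply ℝ ℝ k).contDiffOn
      fun x hx => hmem x hx k
  · intro x hx i j hij
    rw [pd_congr_of_isOpen Metric.isOpen_ball hx fun y hy => hpd y hy i]
    have hdφ : DifferentiableAt ℝ (φ i) (x i) := by
      have h1 : DifferentiableAt ℝ (deriv (w i)) (x i) :=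
        (((hw i).deriv_of_isOpen isOpen_Ioo (m := 1) (by norm_num)).differentiableOn
          one_ne_zero).differentiableAt (isOpen_Ioo.mem_nhds (hmem x hx i))
      refine h1.congr_of_eventuallyEq ?_
      filter_upwards [isOpen_Ioo.mem_nhds (hmem x hx i)] with t ht using
        ((hφ i t ht).1.deriv).symm
    rw [pd_comp_coord hdφ, if_neg hij.symm]
  · intro x hx i
    rw [hpd x hx i]
    exact (hφ i (x i) (hmem x hx i)).2

end Solutions

/-! ### Involution modulo the side condition. -/

section Involution

variable {n : ℕ} {s : Fin (n + 2) → Fin (n + 1) → ℝ → ℝ}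
  {a : Fin (n + 2) → (Fin (n + 2) → ℝ) → ℝ} {v : Fin (n + 2) → ℝ → ℝ}
  {x x₀ p : Fin (n + 2) → ℝ} {ε : ℝ}

theorem differentiableAt_det {E ι : Type*} [NormedAddCommGroup E] [NormedSpace ℝ E] [Fintype ι]
    [DecidableEq ι] {M : E → Matrix ι ι ℝ} {x : E}
    (hM : ∀ i j, DifferentiableAt ℝ (fun y => M y i j) x) :
    DifferentiableAt ℝ (fun y => (M y).det) x := by
  simp only [Matrix.det_apply]
  exact DifferentiableAt.fun_sum fun σ _ =>
    (HasFDerivAt.finsetProd fun i _ => (hM (σ i) i).hasFDerivAt).differentiableAt.const_smul _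

theorem differentiableAt_inv_apply {E ι : Type*} [NormedAddCommGroup E] [NormedSpace ℝ E]
    [Fintype ι] [DecidableEq ι] {M : E → Matrix ι ι ℝ} {x : E}
    (hM : ∀ i j, DifferentiableAt ℝ (fun y => M y i j) x) (hdet : (M x).det ≠ 0) (i j : ι) :
    DifferentiableAt ℝ (fun y => (M y)⁻¹ i j) x := by
  have hadj : DifferentiableAt ℝ (fun y => (M y).adjugate i j) x := by
    simp only [Matrix.adjugate_apply]
    refine differentiableAt_det fun k m => ?_
    by_cases hk : k = j
    · subst hk; simp
    · simpa [Matrix.updateRow_ne hk] using hM k m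
  have : (fun y => (M y)⁻¹ i j) = fun y => ((M y).det)⁻¹ * (M y).adjugate i j := by
    funext y
    simp [Matrix.inv_def]
  rw [this]
  exact ((differentiableAt_det hM).fun_inv hdet).fun_mul hadj

theorem differentiableAt_stackelMatrix (hs : ∀ i ξ, DifferentiableAt ℝ (s i ξ) (x i))
    (ha : ∀ i, DifferentiableAt ℝ (a i) x) (i k : Fin (n + 2)) :
    DifferentiableAt ℝ (fun y => stackelMatrix s a y i k) x := by
  refine Fin.lastCases ?_ (fun ξ => ?_) k
  · simpa using ha i
  · simpa using differentiableAt_comp_coord (hs i ξ)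

/-- Differentiate $\sum_kS_{ik}\mathcal L^k=p_i^2+v_i$ and invert $S$. The columns `s` contribute
only in row `m`, hence only through $T^{km}$; the nonseparated column `a` contributes a multiple of
the last integral. -/
theorem dx_stackelIntegral {B : Set (Fin (n + 2) → ℝ)} (hB : IsOpen B) (hx : x ∈ B)
    (hs : ∀ i ξ, DifferentiableAt ℝ (s i ξ) (x i)) (ha : ∀ i, DifferentiableAt ℝ (a i) x)
    (hv : ∀ i, DifferentiableAt ℝ (v i) (x i))
    (hdet : ∀ y ∈ B, (stackelMatrix s a y).det ≠ 0) (k m : Fin (n + 2)) :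
    dx m (stackelIntegral s a v k) x p =
      (stackelMatrix s a x)⁻¹ k m * (deriv (v m) (x m)
          - ∑ ξ : Fin (n + 1), deriv (s m ξ) (x m) * stackelIntegral s a v ξ.castSucc x p)
        - (∑ i, (stackelMatrix s a x)⁻¹ k i * pd m (a i) x)
          * stackelIntegral s a v (Fin.last (n + 1)) x p := by
  have hS := differentiableAt_stackelMatrix hs ha
  have hT := differentiableAt_inv_apply hS (hdet x hx)
  have hvd := fun i => differentiableAt_comp_coord (hv i)
  have hI : ∀ k, DifferentiableAt ℝ (fun y => stackelIntegral s a v k y p) x := fun k =>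
    DifferentiableAt.fun_sum fun j _ => (hT k j).fun_mul ((hvd j).const_add _)
  let D : Fin (n + 2) → ℝ := fun k => dx m (stackelIntegral s a v k) x p
  have hSpd : ∀ i (ξ : Fin (n + 1)), pd m (fun y => stackelMatrix s a y i ξ.castSucc) x
      = if m = i then deriv (s i ξ) (x i) else 0 := by
    intro i ξ
    simp only [stackelMatrix_castSucc]
    exact pd_comp_coord (hs i ξ)
  have hSpdl : ∀ i, pd m (fun y => stackelMatrix s a y i (Fin.last (n + 1))) x = pd m (a i) x := by
    intro i
    simp only [stackelMatrix_last]
  have hrel : ∀ i, ∑ k, stackelMatrix s a x i k * D k =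
      (if m = i then deriv (v m) (x m)
          - ∑ ξ : Fin (n + 1), deriv (s m ξ) (x m) * stackelIntegral s a v ξ.castSucc x p else 0)
        - pd m (a i) x * stackelIntegral s a v (Fin.last (n + 1)) x p := by
    intro i
    have h1 : pd m (fun y => ∑ k, stackelMatrix s a y i k * stackelIntegral s a v k y p) x
        = if m = i then deriv (v i) (x i) else 0 := by
      have h2 : ∀ y ∈ B, ∑ k, stackelMatrix s a y i k * stackelIntegral s a v k y p
          = p i ^ 2 + v i (y i) := fun y hy =>
        sum_stackelMatrix_mul_sum_inv (𝕜 := ℝ) (hdet y hy) (fun j => p j ^ 2 + v j (y j)) i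
      rw [pd_congr_of_isOpen hB hx h2, pd_add (differentiableAt_const _) (hvd i), pd_const, zero_add, pd_comp_coord (hv i)]
    rw [pd_sum_mul (hS i) hI, Finset.sum_add_distrib] at h1
    change _ + ∑ k, stackelMatrix s a x i k * D k = _ at h1
    rw [Fin.sum_univ_castSucc] at h1
    simp only [hSpd, hSpdl] at h1
    by_cases hmi : m = i
    · subst hmi
      simp only [if_true] at h1 ⊢
      linarith
    · simp only [if_neg hmi, zero_mul, Finset.sum_const_zero] at h1 ⊢
      linarith
  have hD := sum_inv_mul_sum_stackelMatrix (𝕜 := ℝ) (hdet x hx) D k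
  change ∑ i, (stackelMatrix s a x)⁻¹ k i * ∑ j, stackelMatrix s a x i j * D j = D k at hD
  change D k = _
  rw [← hD]
  simp only [hrel, mul_sub, Finset.sum_sub_distrib, mul_ite, mul_zero, Finset.sum_ite_eq,
    Finset.mem_univ, if_true, Finset.sum_mul, mul_assoc]

theorem dp_stackelIntegral (k m : Fin (n + 2)) :
    dp m (stackelIntegral s a v k) x p = 2 * (stackelMatrix s a x)⁻¹ k m * p m := by
  have : stackelIntegral s a v k = quadFn (fun j y => (stackelMatrix s a y)⁻¹ k j)
      fun y => ∑ j, (stackelMatrix s a y)⁻¹ k j * v j (y j) := by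
    funext y q
    simp only [stackelIntegral, quadFn, mul_add, Finset.sum_add_distrib]
  rw [this, dp_quadFn]

/-- In $\partial_{x^j}\mathcal L^k$ the first part is $T^{kj}$ times a factor independent of $k$,
and $\partial_{p_j}\mathcal L^k=2T^{kj}p_j$, so these parts cancel in the antisymmetrized bracket.
What survives is $\mathcal L^N$ times a linear form in the momenta. -/
theorem vanishesMod_poisson_stackelIntegral {B : Set (Fin (n + 2) → ℝ)} (hB : IsOpen B)
    (hs : ∀ x ∈ B, ∀ i ξ, DifferentiableAt ℝ (s i ξ) (x i))
    (ha : ∀ x ∈ B, ∀ i, DifferentiableAt ℝ (a i) x)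
    (hv : ∀ x ∈ B, ∀ i, DifferentiableAt ℝ (v i) (x i))
    (hdet : ∀ x ∈ B, (stackelMatrix s a x).det ≠ 0) (k m : Fin (n + 2)) :
    VanishesMod B (stackelIntegral s a v (Fin.last (n + 1)))
      (poisson (stackelIntegral s a v k) (stackelIntegral s a v m)) := by
  intro x hx
  let β : Fin (n + 2) → Fin (n + 2) → ℝ := fun k j =>
    ∑ i, (stackelMatrix s a x)⁻¹ k i * pd j (a i) x
  refine ⟨∑ j, MvPolynomial.C (2 * (β k j * (stackelMatrix s a x)⁻¹ m j
    - β m j * (stackelMatrix s a x)⁻¹ k j)) * MvPolynomial.X j, fun p _ => ?_⟩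
  simp only [poisson, dp_stackelIntegral,
    dx_stackelIntegral hB hx (hs x hx) (ha x hx) (hv x hx) hdet]
  simp only [map_sum, map_mul, MvPolynomial.eval_C, MvPolynomial.eval_X, Finset.sum_mul]
  refine Finset.sum_congr rfl fun j _ => ?_
  simp only [β, ← Finset.sum_mul]
  ring

end Involution

/-! ### Assembling the matrix and the main theorem. -/

section Construction

variable {N : ℕ} {U : Set (Fin N → ℝ)} {h l : Fin N → (Fin N → ℝ) → ℝ}

theorem update_mem_ball {x₀ : Fin N → ℝ} {ε : ℝ} {i : Fin N} {t : ℝ}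
    (ht : t ∈ Set.Ioo (x₀ i - ε) (x₀ i + ε)) : Function.update x₀ i t ∈ Metric.ball x₀ ε := by
  rw [← Real.ball_eq_Ioo] at ht
  rw [Metric.mem_ball, dist_pi_lt_iff (dist_nonneg.trans_lt ht)]
  intro j
  by_cases hj : j = i
  · subst hj; simpa using ht
  · simpa [hj] using dist_nonneg.trans_lt ht

theorem contDiffOn_dualVec {r : WithTop ℕ∞} (hh : ∀ i, ContDiffOn ℝ r (h i) U)
    (hl : ∀ i, ContDiffOn ℝ r (l i) U)
    (hind : ∀ x ∈ U, LinearIndependent ℝ ![fun i => h i x, fun i => l i x]) (i : Fin N) :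
    ContDiffOn ℝ r (fun x => dualVec (fun k => h k x) (fun k => l k x) i) U := by
  have hsum : ∀ f g : Fin N → (Fin N → ℝ) → ℝ, (∀ i, ContDiffOn ℝ r (f i) U) →
      (∀ i, ContDiffOn ℝ r (g i) U) → ContDiffOn ℝ r (fun x => ∑ k, f k x * g k x) U :=
    fun f g hf hg => ContDiffOn.sum fun k _ => (hf k).mul (hg k)
  exact (((hsum h h hh hh).mul (hl i)).sub ((hsum h l hh hl).mul (hh i))).div
    (((hsum h h hh hh).mul (hsum l l hl hl)).sub ((hsum h l hh hl).mul (hsum h l hh hl)))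
    fun x hx => gram_ne_zero (hind x hx)

end Construction

end NonregSep

theorem theorem3 (n : ℕ) (r : WithTop ℕ∞) (hr : 2 ≤ r)
    (U : Set (Fin (n + 2) → ℝ)) (hU : IsOpen U)
    (h : Fin (n + 2) → (Fin (n + 2) → ℝ) → ℝ) (V : (Fin (n + 2) → ℝ) → ℝ)
    (l : Fin (n + 2) → (Fin (n + 2) → ℝ) → ℝ) (W : (Fin (n + 2) → ℝ) → ℝ)
    (hh : ∀ i, ContDiffOn ℝ r (h i) U) (hV : ContDiffOn ℝ r V U)
    (hl : ∀ i, ContDiffOn ℝ r (l i) U) (hW : ContDiffOn ℝ r W U)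
    (hne : ∀ i, ∀ x ∈ U, h i x ≠ 0)
    (hsep : NonregSep.MaximalNonregularSeparation U h V l W) :
    ∀ x₀ ∈ U, ∃ ε > 0, Metric.ball x₀ ε ⊆ U ∧
      ∃ (s : Fin (n + 2) → Fin (n + 1) → ℝ → ℝ) (a : Fin (n + 2) → (Fin (n + 2) → ℝ) → ℝ)
        (v : Fin (n + 2) → ℝ → ℝ),
        NonregSep.IsGeneralizedStackel r x₀ ε s a ∧
        (∀ i, ContDiffOn ℝ r (v i) (Set.Ioo (x₀ i - ε) (x₀ i + ε))) ∧
        NonregSep.SeparableWithSideCondition x₀ ε h V l W s a v := by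
  open NonregSep in
  intro x₀ hx₀
  obtain ⟨ε₀, hε₀, hε₀U, hprop⟩ := hsep.exists_propagation hU hx₀ (fun i => (hh i).of_le hr)
    (hV.of_le hr) (fun i => (hl i).of_le hr) (hW.of_le hr) hne
  have hind₀ := hsep.independent x₀ hx₀
  have hind₀' := LinearIndependent.pair_symm_iff.1 hind₀
  obtain ⟨b, hb, hbh, hbl⟩ := exists_adapted_basis hind₀
  let s : Fin (n + 2) → Fin (n + 1) → ℝ → ℝ := fun i ξ => axisFn h V x₀ 0 (b ξ) i
  let a : Fin (n + 2) → (Fin (n + 2) → ℝ) → ℝ := fun i x =>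
    dualVec (fun k => h k x) (fun k => l k x) i
  -- These values satisfy $h\cdot q_0=-V$ and $l\cdot q_0=-W$ at the center. With $\kappa=1$ both
  -- sums thus start at 0 and stay 0, and `v` is minus the solution.
  let q₀ : Fin (n + 2) → ℝ := fun i =>
    -V x₀ * dualVec (fun k => l k x₀) (fun k => h k x₀) i
      + -W x₀ * dualVec (fun k => h k x₀) (fun k => l k x₀) i
  let v : Fin (n + 2) → ℝ → ℝ := fun i t => -axisFn h V x₀ 1 q₀ i t
  have hq₀ : ∀ g : Fin (n + 2) → ℝ, ∑ i, g i * q₀ i =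
      -V x₀ * ∑ i, g i * dualVec (fun k => l k x₀) (fun k => h k x₀) i
        + -W x₀ * ∑ i, g i * dualVec (fun k => h k x₀) (fun k => l k x₀) i := by
    intro g
    simp only [q₀, Finset.mul_sum, ← Finset.sum_add_distrib]
    exact Finset.sum_congr rfl fun i _ => by ring
  have hsC : ∀ i ξ, ContDiffOn ℝ r (s i ξ) {t | Function.update x₀ i t ∈ U} := fun i ξ =>
    contDiffOn_axisFn hh hV hne x₀ 0 (b ξ) i
  have hvC : ∀ i, ContDiffOn ℝ r (v i) {t | Function.update x₀ i t ∈ U} := fun i =>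
    (contDiffOn_axisFn hh hV hne x₀ 1 q₀ i).neg
  have haC : ∀ i, ContDiffOn ℝ r (a i) U := contDiffOn_dualVec hh hl hsep.independent
  have hr0 : r ≠ 0 := (two_pos.trans_le hr).ne'
  have hTopen : ∀ i, IsOpen {t : ℝ | Function.update x₀ i t ∈ U} := fun i =>
    hU.preimage (contDiff_update x₀ i 0).continuous
  have hsd : ∀ x : Fin (n + 2) → ℝ, (∀ i, Function.update x₀ i (x i) ∈ U) → ∀ i ξ,
      DifferentiableAt ℝ (s i ξ) (x i) := fun x hx i ξ =>
    ((hsC i ξ).differentiableOn hr0).differentiableAt ((hTopen i).mem_nhds (hx i))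
  have hvd : ∀ x : Fin (n + 2) → ℝ, (∀ i, Function.update x₀ i (x i) ∈ U) → ∀ i,
      DifferentiableAt ℝ (v i) (x i) := fun x hx i =>
    ((hvC i).differentiableOn hr0).differentiableAt ((hTopen i).mem_nhds (hx i))
  have had : ∀ x ∈ U, ∀ i, DifferentiableAt ℝ (a i) x := fun x hx i =>
    ((haC i).differentiableOn hr0).differentiableAt (hU.mem_nhds hx)
  -- At the center the columns `s` are the adapted basis itself; continuity of the determinant then
  -- fixes the second bound `ε₁` on the cube.
  have hdet₀ : (stackelMatrix s a x₀).det ≠ 0 := by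
    refine stackelMatrix_det_ne_zero_of_linearIndependent (l := fun i => l i x₀) ?_ ?_
      (sum_mul_dualVec hind₀)
    · simpa only [s, axisFn_self] using hb
    · simpa only [s, axisFn_self] using hbl
  have hdetc : ContinuousAt (fun x => (stackelMatrix s a x).det) x₀ :=
    (differentiableAt_det (differentiableAt_stackelMatrix
      (hsd x₀ fun i => by simpa using hx₀) (had x₀ hx₀))).continuousAt
  obtain ⟨ε₁, hε₁, hdet₁⟩ := Metric.eventually_nhds_iff_ball.1 (hdetc.eventually_ne hdet₀)
  set ε := min ε₀ ε₁
  have hε : 0 < ε := lt_min hε₀ hε₁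
  have hB₀ : ∀ x ∈ Metric.ball x₀ ε, x ∈ Metric.closedBall x₀ ε₀ := fun x hx =>
    Metric.ball_subset_closedBall (Metric.ball_subset_ball (min_le_left _ _) hx)
  have hBU : Metric.ball x₀ ε ⊆ U := fun x hx => hε₀U (hB₀ x hx)
  have hdet : ∀ x ∈ Metric.ball x₀ ε, (stackelMatrix s a x).det ≠ 0 := fun x hx =>
    hdet₁ x (Metric.ball_subset_ball (min_le_right _ _) hx)
  have hIoo : ∀ i, Set.Ioo (x₀ i - ε) (x₀ i + ε) ⊆ {t | Function.update x₀ i t ∈ U} :=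
    fun i t ht => hBU (update_mem_ball ht)
  have hupd : ∀ x ∈ Metric.ball x₀ ε, ∀ i, Function.update x₀ i (x i) ∈ U := fun x hx i =>
    hIoo i (apply_mem_Ioo_of_mem_ball hx i)
  have hsB := fun i ξ => (hsC i ξ).mono (hIoo i)
  have hvB := fun i => (hvC i).mono (hIoo i)
  have hs_eq : ∀ x ∈ Metric.ball x₀ ε, ∀ ξ,
      ∑ i, h i x * s i ξ (x i) = (if ξ = 0 then 1 else 0) ∧ ∑ i, l i x * s i ξ (x i) = 0 := by
    intro x hx ξ
    -- With $\kappa=0$ the potentials drop out, and the central values $h\cdot b_\xi$ (1 for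
    -- $\xi=0$, otherwise 0) and $l\cdot b_\xi=0$ persist over the cube.
    have := hprop 0 (b ξ) (by simpa [sepSum] using hbl ξ) x (hB₀ x hx)
    simpa [sepSum, hbh] using this
  have hv_eq : ∀ x ∈ Metric.ball x₀ ε,
      V x = ∑ i, v i (x i) * h i x ∧ W x = ∑ i, v i (x i) * l i x := by
    intro x hx
    have h1 : ∑ i, h i x₀ * q₀ i + 1 * V x₀ = 0 := by
      rw [hq₀, sum_mul_dualVec hind₀', sum_mul_dualVec_self]
      ring
    have h2 : ∑ i, l i x₀ * q₀ i + 1 * W x₀ = 0 := by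
      rw [hq₀, sum_mul_dualVec hind₀, sum_mul_dualVec_self]
      ring
    obtain ⟨e1, e2⟩ := hprop 1 q₀ h2 x (hB₀ x hx)
    simp only [sepSum, h1] at e1 e2
    simp only [v, neg_mul, Finset.sum_neg_distrib, mul_comm (axisFn h V x₀ 1 q₀ _ _)]
    constructor <;> linarith
  have hrow_h : ∀ x ∈ Metric.ball x₀ ε, ∀ j, (stackelMatrix s a x)⁻¹ 0 j = h j x := by
    intro x hx
    refine stackelMatrix_inv_row (hdet x hx) fun m => Fin.lastCases ?_ (fun ξ => ?_) m
    · rw [if_neg (Fin.last_pos).ne']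
      simpa using sum_mul_dualVec_self (fun k => h k x) fun k => l k x
    · simpa using (hs_eq x hx ξ).1
  have hrow_l : ∀ x ∈ Metric.ball x₀ ε, ∀ j,
      (stackelMatrix s a x)⁻¹ (Fin.last (n + 1)) j = l j x := by
    intro x hx
    refine stackelMatrix_inv_row (hdet x hx) fun m => Fin.lastCases ?_ (fun ξ => ?_) m
    · simpa using sum_mul_dualVec (hsep.independent x (hBU hx))
    · rw [if_neg (Fin.castSucc_lt_last ξ).ne]
      simpa using (hs_eq x hx ξ).2
  have hfirst : ∀ x ∈ Metric.ball x₀ ε, (∀ j, (stackelMatrix s a x)⁻¹ 0 j = h j x) ∧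
      V x = ∑ j, v j (x j) * (stackelMatrix s a x)⁻¹ 0 j := fun x hx =>
    ⟨hrow_h x hx, by simpa only [hrow_h x hx] using (hv_eq x hx).1⟩
  have hlast : ∀ x ∈ Metric.ball x₀ ε,
      (∀ j, (stackelMatrix s a x)⁻¹ (Fin.last (n + 1)) j = l j x) ∧
      W x = ∑ j, v j (x j) * (stackelMatrix s a x)⁻¹ (Fin.last (n + 1)) j := fun x hx =>
    ⟨hrow_l x hx, by simpa only [hrow_l x hx] using (hv_eq x hx).2⟩
  have hneB : ∀ i, ∀ x ∈ Metric.ball x₀ ε, h i x ≠ 0 := fun i x hx => hne i x (hBU hx)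
  refine ⟨ε, hε, hBU, s, a, v, ⟨hsB, fun i => (haC i).mono hBU, hdet⟩, hvB, hfirst, hlast,
    sepEqsGoverns hneB hdet hfirst hlast, sepEqsGoverns hneB hdet hfirst hlast, ?_, ?_⟩
  · intro c x₁ hx₁ hc
    exact exists_separated_solution (fun i ξ => (hsB i ξ).of_le hr) (fun i => (hvB i).of_le hr)
      c hx₁ hc
  · intro k m x hx
    obtain ⟨P, hP⟩ := vanishesMod_poisson_stackelIntegral Metric.isOpen_ball
      (fun x hx => hsd x (hupd x hx)) (fun x hx => had x (hBU hx))
      (fun x hx => hvd x (hupd x hx)) hdet k m x hx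
    refine ⟨P, fun p hp => ?_⟩
    rw [hP p hp]
    congr 1
    simp only [stackelIntegral, quadFn, mul_add, Finset.sum_add_distrib, (hlast x hx).2,
      hrow_l x hx, mul_comm (l _ x) (v _ _)]
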